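/- Let $G$ be the square grid with vertex set $\mathbb{Z}^2$. Call the unit face of $G$ with lower left corner $(m,n)$ black if $m+n$ is even and white if $m+n$ is odd. Let $\Omega\subset\{0,1\}^{\mathbb{Z}^2}$ be the set of configurations $\omega$ such that around each black face the states, read clockwise from the lower left corner, are one of $0000$, $1111$, $0011$, $1100$, $0110$, $1001$. Let $\mathbb{L}_1$ (primal lattice), respectively $\mathbb{L}_2$ (dual lattice), be the square grid of side length $2$ with vertices $(m-\frac12,n+\frac12)$, $m,n$ both even, respectively both odd. Each black face has the same centre as exactly one edge of $\mathbb{L}_1$ and one edge of $\mathbb{L}_2$, which are perpendicular. For $\omega\in\Omega$, the contour configuration $\phi(\omega)\in\{0,1\}^{E(\mathbb{L}_1)\cup E(\mathbb{L}_2)}$ is defined as follows: for each black face, its two edges are absent (state $0$) if the pattern is $0000$ or $1111$; only the horizontal one is present (state $1$) if the pattern is $1001$ or $0110$; only the vertical one is present if the pattern is $0011$ or $1100$. A contour is a connected component of present edges; it is primal if it consists of edges of $\mathbb{L}_1$, and infinite if it has infinitely many edges. For a probability measure $\mu$ on $\Omega$ (with the product $\sigma$-algebra), let $\nu_1$ be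 the law of the restriction of $\phi(\omega)$ to $E(\mathbb{L}_1)$ when $\omega$ has law $\mu$; it is supported on the set $\Phi_1$ of bond configurations of $\mathbb{L}_1$ in which each vertex has an even number of incident present edges. For a face $S$ of $\mathbb{L}_1$ and $\phi\in\Phi_1$, let $\phi_S$ be obtained from $\phi$ by switching the states of the four sides of $S$, and for an event $E\subseteq\Phi_1$ let $E_S=\{\phi_S:\phi\in E\}$. Theorem. Let $k$ be a positive integer and let $\mu$ be a probability measure on $\Omega$ such that: (i) $\mu$ is invariant under translations by all vectors in $2k\mathbb{Z}\times 2k\mathbb{Z}$; (ii) every $2k\mathbb{Z}\times 2k\mathbb{Z}$-translation-invariant event has $\mu$-probability $0$ or $1$; (iii) (finite energy) $\nu_1(E_S)>0$ for every face $S$ of $\mathbb{L}_1$ and every event $E\subseteq\Phi_1$ with $\nu_1(E)>0$. Then $\mu$-almost surely there is at most one infinite primal contour. -/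

import Mathlib

open MeasureTheory

namespace ConstrainedPercolation

/-! ## Constrained site configurations on the square grid -/

/-- The states of the four corners of the unit face of `ℤ²` with lower left corner `f`, in
clockwise order starting from the lower left corner
(lower left, upper left, upper right, lower right). -/
def pattern (ω : ℤ × ℤ → Bool) (f : ℤ × ℤ) : Bool × Bool × Bool × Bool :=
  (ω f, ω (f + (0, 1)), ω (f + (1, 1)), ω (f + (1, 0)))

/-- The six patterns allowed around a black face:
`0000`, `1111`, `0011`, `1100`, `0110`, `1001`. -/
def allowedPatterns : Finset (Bool × Bool × Bool × Bool) :=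
  {(false, false, false, false), (true, true, true, true),
   (false, false, true, true), (true, true, false, false),
   (false, true, true, false), (true, false, false, true)}

/-- The constraint: every black face (lower left corner `f` with `f.1 + f.2` even) carries an
allowed pattern. -/
def IsConstrained (ω : ℤ × ℤ → Bool) : Prop :=
  ∀ f : ℤ × ℤ, Even (f.1 + f.2) → pattern ω f ∈ allowedPatterns

/-- The constrained percolation state space `Ω`, with the σ-algebra induced by the product
σ-algebra on `{0,1}^{ℤ²}`. -/
abbrev Omega : Type := {ω : ℤ × ℤ → Bool // IsConstrained ω}

/-- Translation of a constrained configuration by the vector `2k z`. -/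
def translate (k : ℕ) (z : ℤ × ℤ) (ω : Omega) : Omega :=
  ⟨fun v => ω.1 (v + (2 * (k : ℤ) * z.1, 2 * (k : ℤ) * z.2)), by
    intro f hf
    have h := ω.2 (f + (2 * (k : ℤ) * z.1, 2 * (k : ℤ) * z.2)) (by
      obtain ⟨r, hr⟩ := hf
      refine ⟨r + k * z.1 + k * z.2, ?_⟩
      simp only [Prod.fst_add, Prod.snd_add]
      linear_combination hr)
    simpa only [pattern, add_right_comm] using h⟩

/-- `μ` is `2kℤ × 2kℤ`-translation-invariant. -/
def IsTranslationInvariant (k : ℕ) (μ : Measure Omega) : Prop :=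
  ∀ z : ℤ × ℤ, MeasurePreserving (translate k z) μ μ

/-- `μ` is `2kℤ × 2kℤ`-ergodic: every `2kℤ × 2kℤ`-translation-invariant event has
probability `0` or `1`. -/
def IsTranslationErgodic (k : ℕ) (μ : Measure Omega) : Prop :=
  ∀ A : Set Omega, MeasurableSet A → (∀ z : ℤ × ℤ, translate k z ⁻¹' A = A) →
    μ A = 0 ∨ μ A = 1

/-! ## The auxiliary lattices `𝕃₁` (primal) and `𝕃₂` (dual) -/

/-- Which of the two auxiliary lattices. -/
inductive Lattice
  | primal
  | dual

/-- The parity of the labels: `𝕃₁` has vertices at the points `(m - 1/2, n + 1/2)` with `m, n`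
even, and `𝕃₂` at those with `m, n` odd. -/
def Lattice.parity : Lattice → ℤ
  | .primal => 0
  | .dual => 1

/-- The two directions of edges. -/
inductive Direction
  | horizontal
  | vertical

/-- An edge of a square grid with vertices indexed by `ℤ²`: the direction of the edge together
with its left (if horizontal) or lower (if vertical) endpoint. -/
abbrev GridEdge : Type := Direction × (ℤ × ℤ)

/-- The left or lower endpoint. -/
def GridEdge.src (e : GridEdge) : ℤ × ℤ := e.2

/-- The right or upper endpoint. -/
def GridEdge.tgt : GridEdge → ℤ × ℤ
  | (.horizontal, v) => v + (1, 0)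
  | (.vertical, v) => v + (0, 1)

/-- The vertices of `𝕃₁` and `𝕃₂`. The vertex `(i, (a, b))`, where `s` is the parity of `i`,
lies at the point `(m - 1/2, n + 1/2)` with `m = 2a + s` and `n = 2b + s`. -/
abbrev AuxVertex : Type := Lattice × (ℤ × ℤ)

/-- The edge set `E(𝕃₁) ∪ E(𝕃₂)`. In both lattices neighbouring vertices are at Euclidean
distance `2`, that is, at distance `1` in the indices `(a, b)`. -/
abbrev AuxEdge : Type := Lattice × GridEdge

/-- The first endpoint of an edge of `𝕃₁` or `𝕃₂`. -/
def AuxEdge.src (e : AuxEdge) : AuxVertex := (e.1, e.2.src)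

/-- The second endpoint of an edge of `𝕃₁` or `𝕃₂`. -/
def AuxEdge.tgt (e : AuxEdge) : AuxVertex := (e.1, e.2.tgt)

/-- The black face of `ℤ²` (given by its lower left corner) having the same centre as the
given edge of `𝕃₁` or `𝕃₂`. The centre is `(2a + s + 1/2, 2b + s + 1/2)` for the horizontal
edge, and `(2a + s - 1/2, 2b + s + 3/2)` for the vertical edge, with left or lower endpoint of
index `(a, b)`. -/
def AuxEdge.blackFace : AuxEdge → ℤ × ℤ
  | (i, (.horizontal, (a, b))) => (2 * a + i.parity, 2 * b + i.parity)
  | (i, (.vertical, (a, b))) => (2 * a + i.parity - 1, 2 * b + i.parity + 1)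

/-! ## Contours -/

/-- The map `φ` from constrained configurations to contour configurations. A horizontal edge is
present when the lower and the upper vertices of the black face that it crosses have different
states, a vertical edge when the left and the right vertices have different states. -/
def contourConfig (ω : Omega) : AuxEdge → Bool
  | (i, (.horizontal, v)) =>
    ω.1 (AuxEdge.blackFace (i, (.horizontal, v))) !=
      ω.1 (AuxEdge.blackFace (i, (.horizontal, v)) + (0, 1))
  | (i, (.vertical, v)) =>
    ω.1 (AuxEdge.blackFace (i, (.vertical, v))) !=
      ω.1 (AuxEdge.blackFace (i, (.vertical, v)) + (1, 0))

/-- The graph on the vertices of `𝕃₁` and `𝕃₂` formed by the present edges of `ψ`. -/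
def presentGraph (ψ : AuxEdge → Bool) : SimpleGraph AuxVertex :=
  SimpleGraph.fromEdgeSet {p | ∃ e : AuxEdge, ψ e = true ∧ p = s(e.src, e.tgt)}

/-- `C` is a contour of `ψ`: the set of edges of a connected component of present edges. -/
def IsContour (ψ : AuxEdge → Bool) (C : Set AuxEdge) : Prop :=
  ∃ e : AuxEdge, ψ e = true ∧
    C = {e' | ψ e' = true ∧ (presentGraph ψ).Reachable e.src e'.src}

/-- A primal contour is a contour consisting of edges of `𝕃₁`. -/
def IsPrimalContour (ψ : AuxEdge → Bool) (C : Set AuxEdge) : Prop :=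
  IsContour ψ C ∧ ∀ e ∈ C, e.1 = Lattice.primal

/-! ## The law of the primal contours and finite energy -/

/-- The restriction of a bond configuration to `E(𝕃₁)`. -/
def primalPart (ψ : AuxEdge → Bool) : GridEdge → Bool :=
  fun e => ψ (Lattice.primal, e)

/-- The law `ν` of the contour configuration when `ω` has law `μ`. -/
noncomputable def contourLaw (μ : Measure Omega) : Measure (AuxEdge → Bool) :=
  μ.map contourConfig

/-- The marginal `ν₁` of `ν` on bond configurations of `𝕃₁`. -/
noncomputable def primalLaw (μ : Measure Omega) : Measure (GridEdge → Bool) :=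
  (contourLaw μ).map primalPart

/-- The maps defining the push-forwards are measurable. -/
theorem measurable_contourConfig : Measurable contourConfig := by
  have h : ∀ v : ℤ × ℤ, Measurable fun ω : Omega => ω.1 v := fun v =>
    (measurable_pi_apply v).comp measurable_subtype_coe
  have h2 : Measurable fun p : Bool × Bool => p.1 != p.2 := measurable_of_countable _
  refine measurable_pi_lambda _ fun e => ?_
  obtain ⟨i, d, v⟩ := e
  cases d <;> exact h2.comp ((h _).prodMk (h _))

theorem measurable_primalPart : Measurable primalPart :=
  measurable_pi_lambda _ fun e => measurable_pi_apply ((Lattice.primal, e) : AuxEdge)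

/-- The four edges of the grid incident to the vertex `v`. -/
def incidentEdges (v : ℤ × ℤ) : List GridEdge :=
  [(.horizontal, v), (.horizontal, v - (1, 0)), (.vertical, v), (.vertical, v - (0, 1))]

/-- The state space `Φ₁`: bond configurations of `𝕃₁` in which each vertex has an even number of
incident present edges. -/
def evenConfigs : Set (GridEdge → Bool) :=
  {φ | ∀ v : ℤ × ℤ, Even ((incidentEdges v).countP φ)}

/-- The four sides of the face `S` of `𝕃₁` whose lower left vertex has index `c`. -/
def faceSides (c : ℤ × ℤ) : Set GridEdge :=
  {(.horizontal, c), (.horizontal, c + (0, 1)), (.vertical, c), (.vertical, c + (1, 0))}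

open Classical in
/-- The configuration `φ_S` obtained from `φ` by switching the states of the four sides of `S`. -/
noncomputable def switchFace (c : ℤ × ℤ) (φ : GridEdge → Bool) : GridEdge → Bool :=
  fun e => if e ∈ faceSides c then !(φ e) else φ e

/-- `ν₁` has finite energy: for every face `S` of `𝕃₁` and every event `E ⊆ Φ₁`,
`ν₁(E) > 0` implies `ν₁(E_S) > 0`, where `E_S = {φ_S : φ ∈ E}`. -/
def HasFiniteEnergy (μ : Measure Omega) : Prop :=
  ∀ c : ℤ × ℤ, ∀ E : Set (GridEdge → Bool), MeasurableSet E → E ⊆ evenConfigs →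
    0 < primalLaw μ E → 0 < primalLaw μ (switchFace c '' E)

end ConstrainedPercolation

/-! The proof is the Burton–Keane argument, adapted to even configurations. Finite energy does not
allow opening a single edge, only switching the four sides of a face. But an even configuration is
the coboundary of a spin configuration on the faces (`exists_coboundary_eq`), and switching a face
flips its spin. The spins in a finite box can therefore be prescribed at will without losing
positivity of probability (`pos_of_forall_exists_switchFaces`). A suitable checkerboard filling
joins, inside the box, all vertices from which a present edge leaves the box, and changes no edge
outside (`exists_switchFaces_isHub`).

By ergodicity, "at least `n` infinite clusters" has probability 0 or 1. If three infinite clusters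
had positive probability, some box would meet three of them, and filling it would produce a
trifurcation with positive probability. By invariance the expected number of disjoint trifurcations
in a square of side of order `r` would then be of order `r²`. However, each one splits its
surroundings into three arms reaching the boundary of the square, and a tree-like count bounds their
number by the size of that boundary, of order `r` (`card_trifurcations_le`).

If there were at least two infinite clusters almost surely, there would thus be exactly two. Filling
a box that meets both would make the infinite cluster unique with positive probability, a
contradiction (`ae_hasUniqueInfinite`). Finally, infinite primal contours are translated into
infinite clusters of vertices. -/

namespace ConstrainedPercolation

/-! ## Connectivity in bond configurations of the square grid -/

/-- `u` and `v` are the endpoints of a present edge of `φ`. -/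
def Link (φ : GridEdge → Bool) (u v : ℤ × ℤ) : Prop :=
  ∃ e : GridEdge, φ e = true ∧ (e.src = u ∧ e.tgt = v ∨ e.src = v ∧ e.tgt = u)

/-- `u` and `v` are joined by a path of present edges of `φ`. -/
def Conn (φ : GridEdge → Bool) : ℤ × ℤ → ℤ × ℤ → Prop :=
  Relation.ReflTransGen (Link φ)

/-- The cluster of `u` in `φ` is infinite. -/
def InfiniteAt (φ : GridEdge → Bool) (u : ℤ × ℤ) : Prop :=
  {v | Conn φ u v}.Infinite

theorem Link.symm {φ : GridEdge → Bool} {u v : ℤ × ℤ} (h : Link φ u v) : Link φ v u := by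
  obtain ⟨e, he, h⟩ := h
  exact ⟨e, he, h.symm⟩

theorem Conn.symm {φ : GridEdge → Bool} {u v : ℤ × ℤ} (h : Conn φ u v) : Conn φ v u := by
  induction h with
  | refl => exact Relation.ReflTransGen.refl
  | tail _ hl ih => exact ih.head hl.symm

theorem Conn.refl (φ : GridEdge → Bool) (u : ℤ × ℤ) : Conn φ u u :=
  Relation.ReflTransGen.refl

theorem Conn.trans {φ : GridEdge → Bool} {u v w : ℤ × ℤ} (h : Conn φ u v) (h' : Conn φ v w) :
    Conn φ u w :=
  Relation.ReflTransGen.trans h h'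

theorem Link.conn {φ : GridEdge → Bool} {u v : ℤ × ℤ} (h : Link φ u v) : Conn φ u v :=
  Relation.ReflTransGen.single h

theorem Link.mono {φ ψ : GridEdge → Bool} (hle : ∀ e, φ e = true → ψ e = true) {u v : ℤ × ℤ}
    (h : Link φ u v) : Link ψ u v := by
  obtain ⟨e, he, h⟩ := h
  exact ⟨e, hle e he, h⟩

theorem Conn.mono {φ ψ : GridEdge → Bool} (hle : ∀ e, φ e = true → ψ e = true) {u v : ℤ × ℤ}
    (h : Conn φ u v) : Conn ψ u v := by
  induction h with
  | refl => exact Relation.ReflTransGen.refl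
  | tail _ hl ih => exact ih.tail (hl.mono hle)

theorem InfiniteAt.of_conn {φ : GridEdge → Bool} {u v : ℤ × ℤ} (h : InfiniteAt φ u)
    (huv : Conn φ u v) : InfiniteAt φ v :=
  Set.Infinite.mono (fun _ hx => huv.symm.trans hx) h

theorem InfiniteAt.exists_link {φ : GridEdge → Bool} {u : ℤ × ℤ} (h : InfiniteAt φ u) :
    ∃ x, Link φ u x := by
  obtain ⟨v, hv, hne⟩ := h.exists_notMem_finite (Set.finite_singleton u)
  rcases Relation.ReflTransGen.cases_head hv with h | ⟨x, hx, -⟩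
  · exact absurd h.symm hne
  · exact ⟨x, hx⟩

theorem link_horizontal {φ : GridEdge → Bool} {x y : ℤ}
    (h : φ (.horizontal, (x, y)) = true) : Link φ (x, y) (x + 1, y) :=
  ⟨_, h, Or.inl ⟨rfl, by simp [GridEdge.tgt]⟩⟩

theorem link_vertical {φ : GridEdge → Bool} {x y : ℤ}
    (h : φ (.vertical, (x, y)) = true) : Link φ (x, y) (x, y + 1) :=
  ⟨_, h, Or.inl ⟨rfl, by simp [GridEdge.tgt]⟩⟩

theorem Link.cases {φ : GridEdge → Bool} {u v : ℤ × ℤ} (h : Link φ u v) :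
    (v = (u.1 + 1, u.2) ∧ φ (.horizontal, u) = true) ∨
    (v = (u.1 - 1, u.2) ∧ φ (.horizontal, v) = true) ∨
    (v = (u.1, u.2 + 1) ∧ φ (.vertical, u) = true) ∨
    (v = (u.1, u.2 - 1) ∧ φ (.vertical, v) = true) := by
  obtain ⟨⟨d, a, b⟩, he, ⟨rfl, rfl⟩ | ⟨rfl, rfl⟩⟩ := h <;> cases d <;>
    simp_all [GridEdge.src, GridEdge.tgt]

/-! ### Cutting a configuration along a finite set of vertices -/

/-- The present edges of `φ` with both endpoints in `V`. -/
def inner (V : Finset (ℤ × ℤ)) (φ : GridEdge → Bool) : GridEdge → Bool :=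
  fun e => φ e && decide (e.src ∈ V ∧ e.tgt ∈ V)

/-- The present edges of `φ` with an endpoint outside `V`. -/
def outer (V : Finset (ℤ × ℤ)) (φ : GridEdge → Bool) : GridEdge → Bool :=
  fun e => φ e && !decide (e.src ∈ V ∧ e.tgt ∈ V)

theorem inner_le (V : Finset (ℤ × ℤ)) (φ : GridEdge → Bool) (e : GridEdge)
    (h : inner V φ e = true) : φ e = true := by
  simp_all [inner]

theorem outer_le (V : Finset (ℤ × ℤ)) (φ : GridEdge → Bool) (e : GridEdge)
    (h : outer V φ e = true) : φ e = true := by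
  simp_all [outer]

theorem inner_le_outer {V W : Finset (ℤ × ℤ)} (hVW : Disjoint V W) (φ : GridEdge → Bool)
    (e : GridEdge) (h : inner W φ e = true) : outer V φ e = true := by
  simp only [inner, outer, Bool.and_eq_true, decide_eq_true_eq, Bool.not_eq_true',
    decide_eq_false_iff_not] at h ⊢
  exact ⟨h.1, fun h' => Finset.disjoint_left.1 hVW h'.1 h.2.1⟩

theorem Link.outer_or_inner {φ : GridEdge → Bool} (V : Finset (ℤ × ℤ)) {u v : ℤ × ℤ}
    (h : Link φ u v) : Link (outer V φ) u v ∨ Link (inner V φ) u v := by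
  obtain ⟨e, he, h⟩ := h
  by_cases hV : e.src ∈ V ∧ e.tgt ∈ V
  · exact Or.inr ⟨e, by simp [inner, he, hV], h⟩
  · exact Or.inl ⟨e, by simp only [outer, he, hV, decide_false, Bool.not_false, Bool.and_true], h⟩

theorem Link.mem_of_inner {φ : GridEdge → Bool} {V : Finset (ℤ × ℤ)} {u v : ℤ × ℤ}
    (h : Link (inner V φ) u v) : u ∈ V ∧ v ∈ V := by
  obtain ⟨e, he, ⟨rfl, rfl⟩ | ⟨rfl, rfl⟩⟩ := h <;> simp_all [inner]

theorem Link.outer_of_notMem {φ : GridEdge → Bool} {V : Finset (ℤ × ℤ)} {u v : ℤ × ℤ}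
    (h : Link φ u v) (hu : u ∉ V) : Link (outer V φ) u v :=
  (h.outer_or_inner V).resolve_right fun h => hu h.mem_of_inner.1

/-- A vertex with an infinite cluster that meets the finite set `V` is joined to a vertex of `V`
whose cluster stays infinite when the edges inside `V` are removed. -/
theorem InfiniteAt.exists_outer {φ : GridEdge → Bool} {V : Finset (ℤ × ℤ)} {w : ℤ × ℤ}
    (hw : w ∈ V) (h : InfiniteAt φ w) : ∃ u ∈ V, Conn φ w u ∧ InfiniteAt (outer V φ) u := by
  by_contra! hcon
  refine h (Set.Finite.subset (Set.Finite.biUnion (s := {u | u ∈ V ∧ Conn φ w u})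
    (t := fun u => {v | Conn (outer V φ) u v}) (V.finite_toSet.subset fun u hu => hu.1)
    fun u hu => Set.not_infinite.1 (hcon u hu.1 hu.2)) ?_)
  intro x hx
  simp only [Set.mem_iUnion, Set.mem_ofPred_eq, exists_prop] at hx ⊢
  induction hx with
  | refl => exact ⟨w, ⟨hw, Conn.refl _ _⟩, Conn.refl _ _⟩
  | tail hb hlink ih =>
    obtain ⟨u, hu, hub⟩ := ih
    rcases hlink.outer_or_inner V with h1 | h1
    · exact ⟨u, hu, hub.tail h1⟩
    · exact ⟨_, ⟨h1.mem_of_inner.2, hb.tail hlink⟩, Conn.refl _ _⟩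

/-- All vertices of `V` with a present edge leading out of `V` are joined inside `V`. -/
def IsHub (V : Finset (ℤ × ℤ)) (φ : GridEdge → Bool) : Prop :=
  ∀ v ∈ V, ∀ w ∈ V, (∃ x, Link (outer V φ) v x) → (∃ x, Link (outer V φ) w x) →
    Conn (inner V φ) v w

/-- There are `n` vertices satisfying `p` that lie in distinct infinite clusters of `φ`. -/
def HasDistinct (n : ℕ) (p : ℤ × ℤ → Prop) (φ : GridEdge → Bool) : Prop :=
  ∃ u : Fin n → ℤ × ℤ, (∀ a, p (u a) ∧ InfiniteAt φ (u a)) ∧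
    ∀ a b, a ≠ b → ¬ Conn φ (u a) (u b)

/-- `V` is a hub from which three distinct infinite clusters emanate. -/
def IsTrifurcation (V : Finset (ℤ × ℤ)) (φ : GridEdge → Bool) : Prop :=
  IsHub V φ ∧ HasDistinct 3 (· ∈ V) (outer V φ)

/-- Deleting the finitely many edges inside `V` leaves an infinite piece of each cluster attached to
`V`, and cannot join distinct clusters. -/
theorem HasDistinct.outer {n : ℕ} {V : Finset (ℤ × ℤ)} {φ : GridEdge → Bool}
    (h : HasDistinct n (· ∈ V) φ) : HasDistinct n (· ∈ V) (outer V φ) := by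
  obtain ⟨u, hu, hne⟩ := h
  choose u' hV hc hinf using fun a => (hu a).2.exists_outer (hu a).1
  refine ⟨u', fun a => ⟨hV a, hinf a⟩, fun a b hab h => hne a b hab ?_⟩
  exact (hc a).trans ((h.mono (outer_le V φ)).trans (hc b).symm)

/-- At most one infinite cluster. -/
def HasUniqueInfinite (φ : GridEdge → Bool) : Prop :=
  ∀ u v, InfiniteAt φ u → InfiniteAt φ v → Conn φ u v

theorem hasUniqueInfinite_iff {φ : GridEdge → Bool} :
    HasUniqueInfinite φ ↔ ¬ HasDistinct 2 (fun _ => True) φ := by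
  constructor
  · rintro h ⟨u, hu, hne⟩
    exact hne 0 1 (by decide) (h _ _ (hu 0).2 (hu 1).2)
  · intro h u v hu hv
    by_contra hne
    refine h ⟨![u, v], ?_, ?_⟩
    · intro a; fin_cases a <;> simp [hu, hv]
    · intro a b hab
      fin_cases a <;> fin_cases b <;> simp_all
      exact fun h => hne h.symm

/-- If `V` is a hub of `ψ`, and `φ` has the same edges as `ψ` outside `V` and all its infinite
clusters meet `V`, then `ψ` has at most one infinite cluster. -/
theorem hasUniqueInfinite_of_isHub {φ ψ : GridEdge → Bool} {V : Finset (ℤ × ℤ)}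
    (hψ : IsHub V ψ) (hout : outer V ψ = outer V φ)
    (hV : ∀ u, InfiniteAt φ u → ∃ w ∈ V, Conn φ u w) : HasUniqueInfinite ψ := by
  have key : ∀ u, InfiniteAt ψ u → ∃ w ∈ V, Conn ψ u w ∧ InfiniteAt (outer V ψ) w := by
    intro u hu
    -- A `ψ`-cluster missing `V` uses only edges that `φ` shares, so `u` is in an infinite cluster
    -- of `φ`, which reaches `V`. The edges of `φ` met before `V` are shared by `ψ`, so the
    -- `ψ`-cluster reaches `V` after all.
    have : ∃ w ∈ V, Conn ψ u w := by
      by_contra! hno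
      have hconn : ∀ x, Conn ψ u x → Conn (outer V ψ) u x := by
        intro x hx
        induction hx with
        | refl => exact Conn.refl _ _
        | tail hb hl ih => exact ih.tail (hl.outer_of_notMem fun hm => hno _ hm hb)
      have hinf : InfiniteAt φ u := by
        refine Set.Infinite.mono (fun x hx => ?_) hu
        have := hconn x hx
        rw [hout] at this
        exact this.mono (outer_le V φ)
      obtain ⟨w, hw, huw⟩ := hV u hinf
      have : ∀ x, Conn φ u x → Conn ψ u x := by
        intro x hx
        induction hx with
        | refl => exact Conn.refl _ _
        | tail hb hl ih =>
          have := hl.outer_of_notMem fun hm => hno _ hm ih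
          rw [← hout] at this
          exact ih.tail (this.mono (outer_le V ψ))
      exact hno w hw (this w huw)
    obtain ⟨w, hw, huw⟩ := this
    obtain ⟨w', hw', hww', hinf⟩ := (hu.of_conn huw).exists_outer hw
    exact ⟨w', hw', huw.trans hww', hinf⟩
  intro u v hu hv
  obtain ⟨a, ha, hua, hai⟩ := key u hu
  obtain ⟨b, hb, hvb, hbi⟩ := key v hv
  exact hua.trans (((hψ a ha b hb hai.exists_link hbi.exists_link).mono
    (inner_le V ψ)).trans hvb.symm)

/-! ### Translations -/

/-- Translation of a bond configuration. -/
def shift (w : ℤ × ℤ) (φ : GridEdge → Bool) : GridEdge → Bool :=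
  fun e => φ (e.1, e.2 + w)

theorem shift_neg_shift (w : ℤ × ℤ) (φ : GridEdge → Bool) : shift (-w) (shift w φ) = φ := by
  funext e; simp [shift]

theorem measurable_shift (w : ℤ × ℤ) : Measurable (shift w) :=
  measurable_pi_lambda _ fun _ => measurable_pi_apply _

theorem Link.of_shift {w : ℤ × ℤ} {φ : GridEdge → Bool} {u v : ℤ × ℤ}
    (h : Link (shift w φ) u v) : Link φ (u + w) (v + w) := by
  obtain ⟨⟨d, x⟩, he, h⟩ := h
  refine ⟨(d, x + w), he, ?_⟩
  rcases h with ⟨rfl, rfl⟩ | ⟨rfl, rfl⟩ <;> cases d <;>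
    simp [GridEdge.src, GridEdge.tgt, add_right_comm]

theorem Conn.of_shift {w : ℤ × ℤ} {φ : GridEdge → Bool} {u v : ℤ × ℤ}
    (h : Conn (shift w φ) u v) : Conn φ (u + w) (v + w) := by
  induction h with
  | refl => exact Conn.refl _ _
  | tail _ hl ih => exact ih.tail hl.of_shift

theorem conn_shift {w : ℤ × ℤ} {φ : GridEdge → Bool} {u v : ℤ × ℤ} :
    Conn (shift w φ) u v ↔ Conn φ (u + w) (v + w) := by
  refine ⟨Conn.of_shift, fun h => ?_⟩
  rw [← shift_neg_shift w φ] at h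
  simpa using h.of_shift

theorem InfiniteAt.of_shift {w : ℤ × ℤ} {φ : GridEdge → Bool} {u : ℤ × ℤ}
    (h : InfiniteAt (shift w φ) u) : InfiniteAt φ (u + w) := by
  refine ((h.image (f := (· + w)) (add_left_injective w).injOn)).mono ?_
  rintro _ ⟨v, hv, rfl⟩
  exact Conn.of_shift hv

theorem HasDistinct.of_shift {n : ℕ} {p q : ℤ × ℤ → Prop} {w : ℤ × ℤ} {φ : GridEdge → Bool}
    (hpq : ∀ v, p v → q (v + w)) (h : HasDistinct n p (shift w φ)) : HasDistinct n q φ := by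
  obtain ⟨u, hu, hne⟩ := h
  refine ⟨fun a => u a + w, fun a => ⟨hpq _ (hu a).1, (hu a).2.of_shift⟩, fun a b hab h => ?_⟩
  exact hne a b hab (conn_shift.2 h)

theorem hasDistinct_shift (n : ℕ) (w : ℤ × ℤ) (φ : GridEdge → Bool) :
    HasDistinct n (fun _ => True) (shift w φ) ↔ HasDistinct n (fun _ => True) φ := by
  refine ⟨HasDistinct.of_shift fun _ h => h, fun h => ?_⟩
  rw [← shift_neg_shift w φ] at h
  exact h.of_shift fun _ h => h

theorem outer_shift {V W : Finset (ℤ × ℤ)} {w : ℤ × ℤ} (hVW : ∀ v, v ∈ V ↔ v + w ∈ W)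
    (φ : GridEdge → Bool) : outer V (shift w φ) = shift w (outer W φ) := by
  funext ⟨d, v⟩
  cases d <;> simp only [outer, shift, hVW, GridEdge.src, GridEdge.tgt, add_right_comm] <;> congr!

theorem inner_shift {V W : Finset (ℤ × ℤ)} {w : ℤ × ℤ} (hVW : ∀ v, v ∈ V ↔ v + w ∈ W)
    (φ : GridEdge → Bool) : inner V (shift w φ) = shift w (inner W φ) := by
  funext ⟨d, v⟩
  cases d <;> simp only [inner, shift, hVW, GridEdge.src, GridEdge.tgt, add_right_comm] <;> congr!

theorem IsTrifurcation.of_shift {V W : Finset (ℤ × ℤ)} {w : ℤ × ℤ}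
    (hVW : ∀ v, v ∈ V ↔ v + w ∈ W) {φ : GridEdge → Bool}
    (h : IsTrifurcation V (shift w φ)) : IsTrifurcation W φ := by
  obtain ⟨h1, h2⟩ := h
  rw [outer_shift hVW] at h2
  refine ⟨?_, h2.of_shift fun v => (hVW v).1⟩
  have hl : ∀ v, (∃ x, Link (outer W φ) v x) → ∃ x, Link (outer V (shift w φ)) (v - w) x := by
    rintro v ⟨x, hx⟩
    rw [← shift_neg_shift w (outer W φ), ← outer_shift hVW] at hx
    exact ⟨_, by simpa [sub_eq_add_neg] using hx.of_shift⟩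
  intro v hv v' hv' ht ht'
  have := h1 (v - w) ((hVW _).2 (by simpa)) (v' - w) ((hVW _).2 (by simpa)) (hl v ht) (hl v' ht')
  rw [inner_shift hVW] at this
  simpa using this.of_shift

/-! ### Measurability -/

/-- This makes `GridEdge` countable, so that unions over edges preserve measurability. -/
instance : Finite Direction :=
  Finite.of_surjective (fun b : Bool => if b then Direction.horizontal else Direction.vertical)
    (by rintro (_ | _); exacts [⟨true, rfl⟩, ⟨false, rfl⟩])

theorem measurableSet_link (u v : ℤ × ℤ) : MeasurableSet {φ | Link φ u v} := by
  simp only [Link, Set.ofPred_exists]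
  refine MeasurableSet.iUnion fun e => ?_
  rw [Set.ofPred_and]
  exact (measurableSet_eq_fun (measurable_pi_apply e) measurable_const).inter (MeasurableSet.const _)

theorem measurableSet_conn (u v : ℤ × ℤ) : MeasurableSet {φ | Conn φ u v} := by
  -- The sequences `w : ℕ → ℤ × ℤ` are uncountable, so the existential is not a countable union as
  -- written. Induction on the length only needs a union over the last vertex but one.
  have hr : ∀ n : ℕ, ∀ v, MeasurableSet
      {φ | ∃ w : ℕ → ℤ × ℤ, w 0 = u ∧ w n = v ∧ ∀ i < n, Link φ (w i) (w (i + 1))} := by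
    intro n
    induction n with
    | zero =>
      intro v
      convert MeasurableSet.const (u = v) using 2
      funext φ
      refine propext ⟨?_, fun h => ⟨fun _ => u, rfl, h, by simp⟩⟩
      rintro ⟨w, h1, h2, -⟩
      exact h1 ▸ h2
    | succ n ih =>
      intro v
      have : {φ | ∃ w : ℕ → ℤ × ℤ, w 0 = u ∧ w (n + 1) = v ∧
          ∀ i < n + 1, Link φ (w i) (w (i + 1))} = ⋃ x : ℤ × ℤ,
          {φ | ∃ w : ℕ → ℤ × ℤ, w 0 = u ∧ w n = x ∧ ∀ i < n, Link φ (w i) (w (i + 1))} ∩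
          {φ | Link φ x v} := by
        ext φ
        simp only [Set.mem_ofPred_eq, Set.mem_iUnion, Set.mem_inter_iff]
        constructor
        · rintro ⟨w, h0, h1, h2⟩
          exact ⟨w n, ⟨w, h0, rfl, fun i hi => h2 i (by omega)⟩, h1 ▸ h2 n (by omega)⟩
        · rintro ⟨x, ⟨w, h0, rfl, h2⟩, h3⟩
          refine ⟨fun i => if i ≤ n then w i else v, by simp [h0], by simp, fun i hi => ?_⟩
          rcases Nat.lt_succ_iff_lt_or_eq.1 hi with hi | rfl
          · simpa [hi.le, Nat.succ_le_of_lt hi] using h2 i hi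
          · simpa using h3
      rw [this]
      exact MeasurableSet.iUnion fun x => (ih x).inter (measurableSet_link x v)
  have : {φ | Conn φ u v} = ⋃ n : ℕ,
      {φ | ∃ w : ℕ → ℤ × ℤ, w 0 = u ∧ w n = v ∧ ∀ i < n, Link φ (w i) (w (i + 1))} := by
    ext φ
    simp only [Set.mem_ofPred_eq, Set.mem_iUnion]
    constructor
    · intro h
      induction h with
      | refl => exact ⟨0, fun _ => u, rfl, rfl, by simp⟩
      | @tail b c hb hl ih =>
        obtain ⟨n, w, h0, h1, h2⟩ := ih
        refine ⟨n + 1, fun i => if i ≤ n then w i else c, by simp [h0], by simp, fun i hi => ?_⟩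
        rcases Nat.lt_succ_iff_lt_or_eq.1 hi with hi | rfl
        · simpa [hi.le, Nat.succ_le_of_lt hi] using h2 i hi
        · simpa [h1] using hl
    · rintro ⟨n, w, rfl, rfl, h⟩
      have : ∀ i ≤ n, Conn φ (w 0) (w i) := by
        intro i
        induction i with
        | zero => exact fun _ => Conn.refl _ _
        | succ i ih => exact fun hi => (ih (by omega)).tail (h i (by omega))
      exact this n le_rfl
  rw [this]
  exact MeasurableSet.iUnion fun n => hr n v

theorem measurableSet_infiniteAt (u : ℤ × ℤ) : MeasurableSet {φ | InfiniteAt φ u} := by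
  have : {φ | InfiniteAt φ u} = ⋂ F : Finset (ℤ × ℤ), ⋃ v : ℤ × ℤ,
      {φ | Conn φ u v} ∩ {_φ : GridEdge → Bool | v ∉ F} := by
    ext φ
    simp only [Set.mem_ofPred_eq, Set.mem_iInter, Set.mem_iUnion, Set.mem_inter_iff]
    constructor
    · exact fun h F => h.exists_notMem_finset F
    · intro h hfin
      obtain ⟨v, hv, hne⟩ := h hfin.toFinset
      exact hne (by simpa using hv)
  rw [this]
  exact MeasurableSet.iInter fun F => MeasurableSet.iUnion fun v =>
    (measurableSet_conn u v).inter (MeasurableSet.const _)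

theorem measurableSet_hasDistinct (n : ℕ) (p : ℤ × ℤ → Prop) :
    MeasurableSet {φ | HasDistinct n p φ} := by
  simp only [HasDistinct, Set.ofPred_exists, Set.ofPred_and, Set.ofPred_forall]
  refine MeasurableSet.iUnion fun u => MeasurableSet.inter ?_ ?_
  · exact MeasurableSet.iInter fun a => (MeasurableSet.const _).inter (measurableSet_infiniteAt _)
  · exact MeasurableSet.iInter fun a => MeasurableSet.iInter fun b => MeasurableSet.iInter fun _ =>
      (measurableSet_conn _ _).compl

theorem measurable_outer (V : Finset (ℤ × ℤ)) : Measurable (outer V) :=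
  measurable_pi_lambda _ fun e =>
    (measurable_of_countable fun b : Bool => b && !decide (e.src ∈ V ∧ e.tgt ∈ V)).comp
      (measurable_pi_apply e)

theorem measurable_inner (V : Finset (ℤ × ℤ)) : Measurable (inner V) :=
  measurable_pi_lambda _ fun e =>
    (measurable_of_countable fun b : Bool => b && decide (e.src ∈ V ∧ e.tgt ∈ V)).comp
      (measurable_pi_apply e)

theorem measurableSet_isTrifurcation (V : Finset (ℤ × ℤ)) :
    MeasurableSet {φ | IsTrifurcation V φ} := by
  have ht : ∀ v, MeasurableSet {φ | ∃ x, Link (outer V φ) v x} := fun v => by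
    rw [Set.ofPred_exists]
    exact MeasurableSet.iUnion fun x => measurable_outer V (measurableSet_link v x)
  refine MeasurableSet.inter ?_ (measurable_outer V (measurableSet_hasDistinct 3 _))
  change MeasurableSet {φ | IsHub V φ}
  simp only [IsHub, Set.ofPred_forall]
  refine MeasurableSet.iInter fun v => MeasurableSet.iInter fun _ => MeasurableSet.iInter fun w =>
    MeasurableSet.iInter fun _ => ?_
  exact (ht v).imp ((ht w).imp (measurable_inner V (measurableSet_conn v w)))

/-! ## Even configurations as coboundaries of spin configurations on the faces -/

/-- The edges separating faces with different spins. -/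
def coboundary (θ : ℤ × ℤ → Bool) : GridEdge → Bool
  | (.horizontal, (x, y)) => θ (x, y) ^^ θ (x, y - 1)
  | (.vertical, (x, y)) => θ (x, y) ^^ θ (x - 1, y)

theorem mem_evenConfigs_iff {φ : GridEdge → Bool} :
    φ ∈ evenConfigs ↔ ∀ x y : ℤ, ((φ (.horizontal, (x, y)) ^^ φ (.horizontal, (x - 1, y))) ^^
      (φ (.vertical, (x, y)) ^^ φ (.vertical, (x, y - 1)))) = false := by
  simp only [evenConfigs, Set.mem_ofPred_eq, Prod.forall]
  refine forall_congr' fun x => forall_congr' fun y => ?_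
  simp only [incidentEdges, List.countP_cons, List.countP_nil, Prod.mk_sub_mk, sub_zero]
  generalize φ (.horizontal, (x, y)) = a
  generalize φ (.horizontal, (x - 1, y)) = b
  generalize φ (.vertical, (x, y)) = c
  generalize φ (.vertical, (x, y - 1)) = d
  revert a b c d
  decide

theorem coboundary_mem_evenConfigs (θ : ℤ × ℤ → Bool) : coboundary θ ∈ evenConfigs := by
  refine mem_evenConfigs_iff.2 fun x y => ?_
  simp only [coboundary]
  generalize θ (x, y) = a
  generalize θ (x, y - 1) = b
  generalize θ (x - 1, y) = c
  generalize θ (x - 1, y - 1) = d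
  revert a b c d
  decide

theorem exists_antidifference (g : ℤ → Bool) :
    ∃ G : ℤ → Bool, G 0 = false ∧ ∀ n, G (n + 1) = (G n ^^ g n) := by
  let P : ℕ → Bool := Nat.rec false fun k b => b ^^ g k
  -- `N k` is the value at `-k`; since `Int.negSucc k` is `-(k + 1)`, the index is raised by one in
  -- `G`.
  let N : ℕ → Bool := Nat.rec false fun k b => b ^^ g (Int.negSucc k)
  let G : ℤ → Bool := fun n => match n with
    | Int.ofNat k => P k
    | Int.negSucc k => N (k + 1)
  refine ⟨G, rfl, fun n => ?_⟩
  match n with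
  | Int.ofNat k => rfl
  | Int.negSucc 0 =>
    change false = ((false ^^ g (Int.negSucc 0)) ^^ g (Int.negSucc 0))
    simp
  | Int.negSucc (k + 1) =>
    change N (k + 1) = ((N (k + 1) ^^ g (Int.negSucc (k + 1))) ^^ g (Int.negSucc (k + 1)))
    simp

/-- Every even configuration is a coboundary. -/
theorem exists_coboundary_eq {φ : GridEdge → Bool} (hφ : φ ∈ evenConfigs) :
    ∃ θ, coboundary θ = φ := by
  rw [mem_evenConfigs_iff] at hφ
  -- Spins are integrated along the row of faces `y = 0` across vertical edges (`A`), then up and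
  -- down each column across horizontal edges (`B`). Only the vertical edges off that row remain to
  -- be checked; evenness at one vertex carries the identity from each row to the next.
  obtain ⟨A, -, hA⟩ := exists_antidifference fun x => φ (.vertical, (x + 1, 0))
  choose B hB0 hB using fun x => exists_antidifference fun y => φ (.horizontal, (x, y + 1))
  refine ⟨fun v => A v.1 ^^ B v.1 v.2, funext ?_⟩
  rintro ⟨_ | _, x, y⟩
  · have := hB x (y - 1)
    simp only [sub_add_cancel] at this
    simp only [coboundary, this]
    cases A x <;> cases B x (y - 1) <;> simp
  · simp only [coboundary]
    have hA' := hA (x - 1)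
    simp only [sub_add_cancel] at hA'
    induction y using Int.induction_on with
    | zero =>
      simp only [hB0, hA']
      cases A (x - 1) <;> simp
    | succ i ih =>
      have h := hφ x (i + 1)
      rw [add_sub_cancel_right, ← ih] at h
      rw [hB, hB]
      exact (by decide : ∀ a b a' b' h h' w : Bool,
        ((h ^^ h') ^^ (w ^^ ((a ^^ b) ^^ (a' ^^ b')))) = false →
        ((a ^^ (b ^^ h)) ^^ (a' ^^ (b' ^^ h'))) = w) _ _ _ _ _ _ _ h
    | pred i ih =>
      have h := hφ x (-i)
      have h1 := hB x (-i - 1)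
      have h2 := hB (x - 1) (-i - 1)
      simp only [sub_add_cancel] at h1 h2
      rw [← ih, h1, h2] at h
      exact (by decide : ∀ a b a' b' h h' w : Bool,
        ((h ^^ h') ^^ (((a ^^ (b ^^ h)) ^^ (a' ^^ (b' ^^ h'))) ^^ w)) = false →
        ((a ^^ b) ^^ (a' ^^ b')) = w) _ _ _ _ _ _ _ h

/-- A face is named by its lower left vertex, and its four sides are exactly the edges whose
coboundary value involves its spin. -/
theorem switchFace_coboundary (c : ℤ × ℤ) (θ : ℤ × ℤ → Bool) :
    switchFace c (coboundary θ) = coboundary (Function.update θ c (!θ c)) := by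
  obtain ⟨a, b⟩ := c
  funext ⟨d, x, y⟩
  cases d
  · simp only [switchFace, faceSides, coboundary, Set.mem_insert_iff, Set.mem_singleton_iff,
      Function.update_apply, Prod.mk.injEq, Prod.mk_add_mk, reduceCtorEq, true_and, false_and,
      or_false, add_zero, sub_eq_iff_eq_add]
    by_cases hx : x = a
    · subst hx
      by_cases h1 : y = b
      · subst h1; simp
      · by_cases h2 : y = b + 1
        · subst h2; simp
        · simp [h1, h2]
    · simp [hx]
  · simp only [switchFace, faceSides, coboundary, Set.mem_insert_iff, Set.mem_singleton_iff,
      Function.update_apply, Prod.mk.injEq, Prod.mk_add_mk, reduceCtorEq, true_and, false_and,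
      false_or, add_zero, sub_eq_iff_eq_add]
    by_cases hy : y = b
    · subst hy
      by_cases h1 : x = a
      · subst h1; simp
      · by_cases h2 : x = a + 1
        · subst h2; simp
        · simp [h1, h2]
    · simp [hy]

theorem measurable_switchFace (c : ℤ × ℤ) : Measurable (switchFace c) := by
  refine measurable_pi_lambda _ fun e => ?_
  by_cases h : e ∈ faceSides c
  · simp only [switchFace, h, if_true]
    exact (measurable_of_countable fun b : Bool => !b).comp (measurable_pi_apply e)
  · simp only [switchFace, h, if_false]
    exact measurable_pi_apply e

/-- Switch the faces in a list successively. -/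
noncomputable def switchFaces (T : List (ℤ × ℤ)) (φ : GridEdge → Bool) : GridEdge → Bool :=
  T.foldr switchFace φ

/-- The spins of finitely many faces can be prescribed by switching faces. -/
theorem exists_switchFaces_eq (F : Finset (ℤ × ℤ)) (s θ : ℤ × ℤ → Bool) :
    ∃ T, switchFaces T (coboundary θ) = coboundary fun c => if c ∈ F then s c else θ c := by
  induction F using Finset.induction_on with
  | empty => exact ⟨[], by simp [switchFaces]⟩
  | insert c F hc ih =>
    obtain ⟨T, hT⟩ := ih
    by_cases hs : s c = θ c
    · refine ⟨T, hT.trans (congrArg _ (funext fun x => ?_))⟩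
      grind
    · refine ⟨c :: T, ?_⟩
      change switchFace c (switchFaces T (coboundary θ)) = _
      rw [hT, switchFace_coboundary]
      refine congrArg _ (funext fun x => ?_)
      by_cases hx : x = c
      · subst hx
        simp [hc, Bool.eq_not_of_ne (Ne.symm hs)]
      · simp [hx]

/-! ## Joining all clusters that meet a box -/

/-- The vertices of the box of radius `m` around `c`. -/
noncomputable def box (m : ℤ) (c : ℤ × ℤ) : Finset (ℤ × ℤ) :=
  Finset.Icc (c.1 - m, c.2 - m) (c.1 + m, c.2 + m)

theorem mem_box {m : ℤ} {c v : ℤ × ℤ} :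
    v ∈ box m c ↔ (c.1 - m ≤ v.1 ∧ c.2 - m ≤ v.2) ∧ v.1 ≤ c.1 + m ∧ v.2 ≤ c.2 + m := by
  simp [box, Prod.le_def]

/-- The spins used inside the box `[-m, m]²`: a checkerboard, up to a flip in each quadrant chosen so
that the horizontal side of the box at each corner becomes present next to the spins `θ`. -/
def fillSpin (m : ℤ) (θ : ℤ × ℤ → Bool) (v : ℤ × ℤ) : Bool :=
  let X := if 0 ≤ v.1 then m - 1 else -m
  let Y := if 0 ≤ v.2 then m - 1 else -m
  let Y' := if 0 ≤ v.2 then m else -m - 1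
  decide ((v.1 + v.2 + X + Y) % 2 = 0) ^^ θ (X, Y')

/-- The spins `θ`, replaced by `fillSpin` inside the box `[-m, m]²`. -/
noncomputable def filled (m : ℤ) (θ : ℤ × ℤ → Bool) (v : ℤ × ℤ) : Bool :=
  if v ∈ Finset.Icc (-m, -m) (m - 1, m - 1) then fillSpin m θ v else θ v

theorem filled_of_mem {m : ℤ} {θ : ℤ × ℤ → Bool} {x y : ℤ}
    (h : -m ≤ x ∧ x < m ∧ -m ≤ y ∧ y < m) : filled m θ (x, y) = fillSpin m θ (x, y) :=
  if_pos (by simp only [Finset.mem_Icc, Prod.mk_le_mk]; omega)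

theorem filled_of_notMem {m : ℤ} {θ : ℤ × ℤ → Bool} {x y : ℤ}
    (h : ¬ (-m ≤ x ∧ x < m ∧ -m ≤ y ∧ y < m)) : filled m θ (x, y) = θ (x, y) :=
  if_neg (by simp only [Finset.mem_Icc, Prod.mk_le_mk]; omega)

/-- For `x ≠ 0` the faces on the two sides lie in the same quadrant, hence carry the same flip and
opposite checkerboard colours. Edges on the axis `x = 0` are not controlled. -/
theorem coboundary_filled_vertical {m : ℤ} {θ : ℤ × ℤ → Bool} {x y : ℤ} (hx : -m < x ∧ x < m)
    (hx0 : x ≠ 0) (hy : -m ≤ y ∧ y < m) :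
    coboundary (filled m θ) (.vertical, (x, y)) = true := by
  have h0 : (0 ≤ x - 1) = (0 ≤ x) := propext (by omega)
  simp only [coboundary]
  rw [filled_of_mem (by omega), filled_of_mem (by omega)]
  simp only [fillSpin, h0]
  generalize (if 0 ≤ x then m - 1 else -m) = X
  generalize (if 0 ≤ y then m - 1 else -m) = Y
  generalize (if 0 ≤ y then m else -m - 1) = Y'
  have : decide ((x - 1 + y + X + Y) % 2 = 0) = !decide ((x + y + X + Y) % 2 = 0) := by
    rw [← decide_not]
    exact decide_eq_decide.2 (by omega)
  rw [this]
  generalize decide ((x + y + X + Y) % 2 = 0) = p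
  cases p <;> cases θ (X, Y') <;> rfl

theorem coboundary_filled_horizontal {m : ℤ} {θ : ℤ × ℤ → Bool} {x y : ℤ} (hx : -m ≤ x ∧ x < m)
    (hy : -m < y ∧ y < m) (hy0 : y ≠ 0) :
    coboundary (filled m θ) (.horizontal, (x, y)) = true := by
  have h0 : (0 ≤ y - 1) = (0 ≤ y) := propext (by omega)
  simp only [coboundary]
  rw [filled_of_mem (by omega), filled_of_mem (by omega)]
  simp only [fillSpin, h0]
  generalize (if 0 ≤ x then m - 1 else -m) = X
  generalize (if 0 ≤ y then m - 1 else -m) = Y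
  generalize (if 0 ≤ y then m else -m - 1) = Y'
  have : decide ((x + (y - 1) + X + Y) % 2 = 0) = !decide ((x + y + X + Y) % 2 = 0) := by
    rw [← decide_not]
    exact decide_eq_decide.2 (by omega)
  rw [this]
  generalize decide ((x + y + X + Y) % 2 = 0) = p
  cases p <;> cases θ (X, Y') <;> rfl

theorem coboundary_filled_corner {m : ℤ} (hm : 2 ≤ m) {θ : ℤ × ℤ → Bool} {x y : ℤ}
    (hx : x = m - 1 ∨ x = -m) (hy : y = m ∨ y = -m) :
    coboundary (filled m θ) (.horizontal, (x, y)) = true := by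
  simp only [coboundary]
  have hX : (if 0 ≤ x then m - 1 else -m) = x := by split_ifs <;> omega
  rcases hy with rfl | rfl
  · rw [filled_of_notMem (by omega), filled_of_mem (by omega)]
    -- At the corner face itself `fillSpin` is the negation of `θ` at the face just beyond the
    -- horizontal side.
    have h1 : (x + (y - 1) + x + (y - 1)) % 2 = 0 := by omega
    simp [fillSpin, hX, h1, show 1 ≤ y by omega]
  · rw [filled_of_mem (by omega), filled_of_notMem (by omega)]
    have h1 : (x + -m + x + -m) % 2 = 0 := by omega
    simp [fillSpin, hX, h1, show ¬ m ≤ 0 by omega]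

theorem inner_box_eq_true {m : ℤ} {ψ : GridEdge → Bool} {e : GridEdge} (h : ψ e = true)
    (h1 : -m ≤ e.src.1 ∧ -m ≤ e.src.2) (h2 : e.tgt.1 ≤ m ∧ e.tgt.2 ≤ m) :
    inner (box m 0) ψ e = true := by
  obtain ⟨_ | _, x, y⟩ := e <;>
    simp only [GridEdge.src, GridEdge.tgt, Prod.mk_add_mk] at h1 h2 <;>
    simp only [inner, h, Bool.true_and, decide_eq_true_eq, mem_box, GridEdge.src, GridEdge.tgt,
      Prod.mk_add_mk, Prod.fst_zero, Prod.snd_zero] <;> omega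

theorem conn_vertical_line {η : GridEdge → Bool} {x a b : ℤ}
    (h : ∀ y, a ≤ y → y < b → η (.vertical, (x, y)) = true) {y : ℤ} (hy : a ≤ y) (hyb : y ≤ b) :
    Conn η (x, a) (x, y) := by
  induction y, hy using Int.leInduction with
  | base => exact Conn.refl _ _
  | succ y hy ih => exact (ih (by omega)).tail (link_vertical (h y hy (by omega)))

theorem conn_horizontal_line {η : GridEdge → Bool} {y a b : ℤ}
    (h : ∀ x, a ≤ x → x < b → η (.horizontal, (x, y)) = true) {x : ℤ} (hx : a ≤ x) (hxb : x ≤ b) :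
    Conn η (a, y) (x, y) := by
  induction x, hx using Int.leInduction with
  | base => exact Conn.refl _ _
  | succ x hx ih => exact (ih (by omega)).tail (link_horizontal (h x hx (by omega)))

theorem outer_box_eq_true {m : ℤ} {ψ : GridEdge → Bool} {e : GridEdge}
    (h : outer (box m 0) ψ e = true) : ψ e = true ∧
      ¬ (-m ≤ e.src.1 ∧ -m ≤ e.src.2 ∧ e.tgt.1 ≤ m ∧ e.tgt.2 ≤ m) := by
  refine ⟨outer_le _ _ _ h, fun h1 => ?_⟩
  have := inner_box_eq_true (outer_le _ _ _ h) ⟨h1.1, h1.2.1⟩ h1.2.2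
  simp only [outer, inner, Bool.and_eq_true] at h this
  rw [this.2] at h
  simp at h

/-- All grid lines strictly inside the box, except the two axes, are fully present and cross each
other. Off these lines lie only the centre, which has no edge leaving the box, the four corners and
the midpoints of the four sides. A corner is joined to the nearest line by
`coboundary_filled_corner`. At a midpoint with an edge leaving the box, evenness forces a second
present edge, and its other end lies on one of the lines; `2 ≤ m` ensures this. -/
theorem isHub_coboundary_filled {m : ℤ} (hm : 2 ≤ m) (θ : ℤ × ℤ → Bool) :
    IsHub (box m 0) (coboundary (filled m θ)) := by
  set ψ := coboundary (filled m θ) with hψ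
  have heven := mem_evenConfigs_iff.1 (coboundary_mem_evenConfigs (filled m θ))
  have hv : ∀ x, -m < x → x < m → x ≠ 0 → ∀ y, -m ≤ y → y < m →
      inner (box m 0) ψ (.vertical, (x, y)) = true := fun x h1 h2 h3 y h4 h5 =>
    inner_box_eq_true (coboundary_filled_vertical ⟨h1, h2⟩ h3 ⟨h4, h5⟩)
      (by simp only [GridEdge.src]; omega)
      (by simp only [GridEdge.tgt, Prod.mk_add_mk]; omega)
  have hh : ∀ y, -m < y → y < m → y ≠ 0 → ∀ x, -m ≤ x → x < m →
      inner (box m 0) ψ (.horizontal, (x, y)) = true := fun y h1 h2 h3 x h4 h5 =>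
    inner_box_eq_true (coboundary_filled_horizontal ⟨h4, h5⟩ ⟨h1, h2⟩ h3)
      (by simp only [GridEdge.src]; omega)
      (by simp only [GridEdge.tgt, Prod.mk_add_mk]; omega)
  have lv : ∀ x, -m < x → x < m → x ≠ 0 → ∀ y, -m ≤ y → y ≤ m → ∀ y', -m ≤ y' → y' ≤ m →
      Conn (inner (box m 0) ψ) (x, y) (x, y') := fun x h1 h2 h3 y h4 h5 y' h6 h7 =>
    (conn_vertical_line (hv x h1 h2 h3) h4 h5).symm.trans
      (conn_vertical_line (hv x h1 h2 h3) h6 h7)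
  have lh : ∀ y, -m < y → y < m → y ≠ 0 → ∀ x, -m ≤ x → x ≤ m → ∀ x', -m ≤ x' → x' ≤ m →
      Conn (inner (box m 0) ψ) (x, y) (x', y) := fun y h1 h2 h3 x h4 h5 x' h6 h7 =>
    (conn_horizontal_line (hh y h1 h2 h3) h4 h5).symm.trans
      (conn_horizontal_line (hh y h1 h2 h3) h6 h7)
  have cv : ∀ x y, -m < x → x < m → x ≠ 0 → -m ≤ y → y ≤ m →
      Conn (inner (box m 0) ψ) (1, 1) (x, y) := fun x y h1 h2 h3 h4 h5 =>
    (lh 1 (by omega) (by omega) (by omega) 1 (by omega) (by omega) x (by omega) (by omega)).trans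
      (lv x h1 h2 h3 1 (by omega) (by omega) y h4 h5)
  have ch : ∀ x y, -m < y → y < m → y ≠ 0 → -m ≤ x → x ≤ m →
      Conn (inner (box m 0) ψ) (1, 1) (x, y) := fun x y h1 h2 h3 h4 h5 =>
    (lv 1 (by omega) (by omega) (by omega) 1 (by omega) (by omega) y (by omega) (by omega)).trans
      (lh y h1 h2 h3 1 (by omega) (by omega) x h4 h5)
  have stepv : ∀ x y, -m ≤ x → x ≤ m → -m ≤ y → y < m → ψ (.vertical, (x, y)) = true →
      Conn (inner (box m 0) ψ) (x, y) (x, y + 1) := fun x y h1 h2 h3 h4 h =>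
    (link_vertical (inner_box_eq_true h (by simp only [GridEdge.src]; omega)
      (by simp only [GridEdge.tgt, Prod.mk_add_mk]; omega))).conn
  have steph : ∀ x y, -m ≤ x → x < m → -m ≤ y → y ≤ m → ψ (.horizontal, (x, y)) = true →
      Conn (inner (box m 0) ψ) (x, y) (x + 1, y) := fun x y h1 h2 h3 h4 h =>
    (link_horizontal (inner_box_eq_true h (by simp only [GridEdge.src]; omega)
      (by simp only [GridEdge.tgt, Prod.mk_add_mk]; omega))).conn
  have main : ∀ v ∈ box m 0, (∃ z, Link (outer (box m 0) ψ) v z) →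
      Conn (inner (box m 0) ψ) (1, 1) v := by
    rintro ⟨x, y⟩ hmem ⟨z, hz⟩
    simp only [mem_box, Prod.fst_zero, Prod.snd_zero] at hmem
    by_cases h1 : -m < x ∧ x < m ∧ x ≠ 0
    · exact cv x y h1.1 h1.2.1 h1.2.2 (by omega) (by omega)
    by_cases h2 : -m < y ∧ y < m ∧ y ≠ 0
    · exact ch x y h2.1 h2.2.1 h2.2.2 (by omega) (by omega)
    -- An edge leaving the box crosses a side perpendicularly.
    have hout : (ψ (.horizontal, (x, y)) = true ∧ x = m) ∨
        (ψ (.horizontal, (x - 1, y)) = true ∧ x = -m) ∨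
        (ψ (.vertical, (x, y)) = true ∧ y = m) ∨
        (ψ (.vertical, (x, y - 1)) = true ∧ y = -m) := by
      rcases hz.cases with ⟨rfl, h⟩ | ⟨rfl, h⟩ | ⟨rfl, h⟩ | ⟨rfl, h⟩ <;>
        obtain ⟨h3, h4⟩ := outer_box_eq_true h <;>
        simp only [GridEdge.src, GridEdge.tgt, Prod.mk_add_mk] at h4 <;>
        simp only [h3, true_and] <;> omega
    have hxy := heven x y
    rw [← hψ] at hxy
    by_cases hy : y = m ∨ y = -m
    · by_cases hx : x = 0
      · have h3 : ψ (.horizontal, (x, y)) = true ∨ ψ (.horizontal, (x - 1, y)) = true ∨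
            (y = -m ∧ ψ (.vertical, (x, y)) = true) ∨
            (y = m ∧ ψ (.vertical, (x, y - 1)) = true) := by
          rcases hout with h | h | h | h
          · omega
          · omega
          · clear heven hv hh lv lh cv ch stepv steph; grind
          · clear heven hv hh lv lh cv ch stepv steph; grind
        rcases h3 with h3 | h3 | ⟨h4, h3⟩ | ⟨h4, h3⟩
        · exact (cv (x + 1) y (by omega) (by omega) (by omega) (by omega) (by omega)).trans
            (steph x y (by omega) (by omega) (by omega) (by omega) h3).symm
        · simpa using (cv (x - 1) y (by omega) (by omega) (by omega) (by omega) (by omega)).trans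
            (steph (x - 1) y (by omega) (by omega) (by omega) (by omega) h3)
        · exact (ch x (y + 1) (by omega) (by omega) (by omega) (by omega) (by omega)).trans
            (stepv x y (by omega) (by omega) (by omega) (by omega) h3).symm
        · simpa using (ch x (y - 1) (by omega) (by omega) (by omega) (by omega) (by omega)).trans
            (stepv x (y - 1) (by omega) (by omega) (by omega) (by omega) h3)
      · have hx' : x = m ∨ x = -m := by omega
        rcases hx' with hx' | hx'
        · have := coboundary_filled_corner hm (θ := θ) (x := x - 1) (y := y) (by omega) hy
          simpa using (cv (x - 1) y (by omega) (by omega) (by omega) (by omega) (by omega)).trans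
            (steph (x - 1) y (by omega) (by omega) (by omega) (by omega) this)
        · have := coboundary_filled_corner hm (θ := θ) (x := x) (y := y) (by omega) hy
          exact (cv (x + 1) y (by omega) (by omega) (by omega) (by omega) (by omega)).trans
            (steph x y (by omega) (by omega) (by omega) (by omega) this).symm
    · have hy0 : y = 0 := by omega
      have h3 : ψ (.vertical, (x, y)) = true ∨ ψ (.vertical, (x, y - 1)) = true ∨
          (x = -m ∧ ψ (.horizontal, (x, y)) = true) ∨
          (x = m ∧ ψ (.horizontal, (x - 1, y)) = true) := by
        rcases hout with h | h | h | h
        · clear heven hv hh lv lh cv ch stepv steph; grind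
        · clear heven hv hh lv lh cv ch stepv steph; grind
        · omega
        · omega
      have hx' : x = m ∨ x = -m := by omega
      rcases h3 with h3 | h3 | ⟨h4, h3⟩ | ⟨h4, h3⟩
      · exact (ch x (y + 1) (by omega) (by omega) (by omega) (by omega) (by omega)).trans
          (stepv x y (by omega) (by omega) (by omega) (by omega) h3).symm
      · simpa using (ch x (y - 1) (by omega) (by omega) (by omega) (by omega) (by omega)).trans
          (stepv x (y - 1) (by omega) (by omega) (by omega) (by omega) h3)
      · exact (cv (x + 1) y (by omega) (by omega) (by omega) (by omega) (by omega)).trans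
          (steph x y (by omega) (by omega) (by omega) (by omega) h3).symm
      · simpa using (cv (x - 1) y (by omega) (by omega) (by omega) (by omega) (by omega)).trans
          (steph (x - 1) y (by omega) (by omega) (by omega) (by omega) h3)
  intro v hv w hw hvt hwt
  exact (main v hv hvt).symm.trans (main w hw hwt)

theorem outer_coboundary_filled (m : ℤ) (θ : ℤ × ℤ → Bool) :
    outer (box m 0) (coboundary (filled m θ)) = outer (box m 0) (coboundary θ) := by
  funext e
  by_cases he : e.src ∈ box m 0 ∧ e.tgt ∈ box m 0
  · simp [outer, he]
  · have : coboundary (filled m θ) e = coboundary θ e := by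
      obtain ⟨_ | _, x, y⟩ := e <;>
        simp only [mem_box, GridEdge.src, GridEdge.tgt, Prod.mk_add_mk, Prod.fst_zero,
          Prod.snd_zero] at he <;> simp only [coboundary] <;>
        rw [filled_of_notMem (by omega), filled_of_notMem (by omega)]
    simp only [outer, this]

/-- By switching faces inside a box, all clusters meeting the box can be joined inside it. -/
theorem exists_switchFaces_isHub {φ : GridEdge → Bool} (hφ : φ ∈ evenConfigs) {m : ℤ}
    (hm : 2 ≤ m) : ∃ T, outer (box m 0) (switchFaces T φ) = outer (box m 0) φ ∧
      IsHub (box m 0) (switchFaces T φ) := by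
  obtain ⟨θ, rfl⟩ := exists_coboundary_eq hφ
  obtain ⟨T, hT⟩ := exists_switchFaces_eq (Finset.Icc (-m, -m) (m - 1, m - 1)) (fillSpin m θ) θ
  refine ⟨T, ?_⟩
  rw [hT]
  exact ⟨outer_coboundary_filled m θ, isHub_coboundary_filled hm θ⟩

/-! ## The Burton–Keane counting argument -/

theorem exists_ne_ne_of_disjoint {α : Type*} {S : Fin 3 → Set α} (hne : ∀ a, (S a).Nonempty)
    (hdisj : ∀ a b, a ≠ b → Disjoint (S a) (S b)) (P : Set α) (a : Fin 3) :
    ∃ b, b ≠ a ∧ S b ≠ P := by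
  by_contra! h
  have h1 := h (a + 1) (by fin_cases a <;> decide)
  have h2 := h (a + 2) (by fin_cases a <;> decide)
  have := hdisj (a + 1) (a + 2) (by fin_cases a <;> decide)
  rw [h1, h2, disjoint_self, ← h1] at this
  exact (hne (a + 1)).ne_empty this

/-- A family of pairwise compatible triples of disjoint subsets, all meeting the finite set `Y`,
has at most `|Y|` members. Compatible means that one of the classes `P` of the `j`-th partition and
one of the classes `Q` of the `i`-th partition cover everything. -/
theorem card_le_card_of_compatible {ι α : Type*} (K : ι → Fin 3 → Set α) (J : Finset ι)
    (Y : Finset α) (hne : ∀ j ∈ J, ∀ a, ∃ y ∈ Y, y ∈ K j a)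
    (hdisj : ∀ j ∈ J, ∀ a b, a ≠ b → Disjoint (K j a) (K j b))
    (hcomp : ∀ i ∈ J, ∀ j ∈ J, i ≠ j → ∃ P Q : Set α,
      (∀ a, K j a = P ∨ K j a ⊆ Q ∧ Disjoint (K j a) P) ∧
      ∀ b, K i b = Q ∨ K i b ⊆ P ∧ Disjoint (K i b) Q) :
    J.card ≤ Y.card := by
  classical
  induction hn : J.card generalizing J Y with
  | zero => exact Nat.zero_le _
  | succ n ih =>
    have hJ : J.Nonempty := Finset.card_pos.1 (by omega)
    -- A class with fewest points of `Y` plays the role of a leaf: the induction removes `j` and one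
    -- point of this class.
    obtain ⟨⟨j, a⟩, hja, hmin⟩ := Finset.exists_min_image (J ×ˢ (Finset.univ : Finset (Fin 3)))
      (fun q => (Y.filter (· ∈ K q.1 q.2)).card) (hJ.product Finset.univ_nonempty)
    have hj : j ∈ J := (Finset.mem_product.1 hja).1
    have hnon : ∀ i ∈ J, ∀ b, (K i b).Nonempty := fun i hi b =>
      (hne i hi b).imp fun _ h => h.2
    obtain ⟨y, hyY, hy⟩ := hne j hj a
    have hle := ih (J.erase j) (Y.erase y) ?_
      (fun i hi => hdisj i (Finset.mem_of_mem_erase hi))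
      (fun i hi i' hi' => hcomp i (Finset.mem_of_mem_erase hi) i' (Finset.mem_of_mem_erase hi'))
      (by rw [Finset.card_erase_of_mem hj]; omega)
    · have := Finset.card_erase_add_one hyY
      omega
    intro i hi b
    obtain ⟨hij, hi⟩ := Finset.mem_erase.1 hi
    obtain ⟨P, Q, hP, hQ⟩ := hcomp i hi j hj hij
    -- Otherwise two disjoint classes of `i` lie in `K j a`, and each has strictly fewer points of
    -- `Y`.
    have haP : K j a ≠ P := by
      intro haP
      obtain ⟨b₁, -, h₁⟩ := exists_ne_ne_of_disjoint (hnon i hi) (hdisj i hi) Q 0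
      obtain ⟨b₂, h₁₂, h₂⟩ := exists_ne_ne_of_disjoint (hnon i hi) (hdisj i hi) Q b₁
      have s₁ := ((hQ b₁).resolve_left h₁).1
      have s₂ := ((hQ b₂).resolve_left h₂).1
      obtain ⟨z, hzY, hz⟩ := hne i hi b₂
      have hlt : (Y.filter (· ∈ K i b₁)).card < (Y.filter (· ∈ K j a)).card := by
        refine Finset.card_lt_card (Finset.ssubset_iff_of_subset ?_ |>.2 ⟨z, ?_, ?_⟩)
        · intro x hx
          simp only [Finset.mem_filter] at hx ⊢
          exact ⟨hx.1, haP ▸ s₁ hx.2⟩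
        · simp only [Finset.mem_filter]
          exact ⟨hzY, haP ▸ s₂ hz⟩
        · simp only [Finset.mem_filter, not_and]
          exact fun _ hz' => Set.disjoint_left.1 (hdisj i hi b₂ b₁ h₁₂) hz hz'
      exact absurd (hmin (i, b₁) (by simp [hi])) (not_le.2 hlt)
    obtain ⟨haQ, hdP⟩ := (hP a).resolve_left haP
    obtain ⟨a', haa', ha'⟩ := exists_ne_ne_of_disjoint (hnon j hj) (hdisj j hj) P a
    -- Only a class equal to `Q` can lose `y`, and it contains a second class of `j`, which supplies
    -- another point of `Y`.
    by_cases hyi : y ∈ K i b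
    · rcases hQ b with hb | ⟨hb, -⟩
      · obtain ⟨z, hzY, hz⟩ := hne j hj a'
        refine ⟨z, Finset.mem_erase.2 ⟨?_, hzY⟩, hb ▸ ((hP a').resolve_left ha').1 hz⟩
        rintro rfl
        exact Set.disjoint_left.1 (hdisj j hj a' a haa') hz hy
      · exact absurd (hb hyi) (Set.disjoint_left.1 hdP hy)
    · obtain ⟨z, hzY, hz⟩ := hne i hi b
      exact ⟨z, Finset.mem_erase.2 ⟨fun h => hyi (h ▸ hz), hzY⟩, hz⟩

/-- A cluster outside `V` that is not joined outside `V` to the hub `W` does not use edges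
inside `W`. -/
theorem Conn.outer_of_not_conn {V W : Finset (ℤ × ℤ)} (hVW : Disjoint V W) {φ : GridEdge → Bool}
    (hW : IsHub W φ) {w : ℤ × ℤ} (hw : w ∈ W) (hwt : ∃ x, Link (outer W φ) w x) {u x : ℤ × ℤ}
    (hu : u ∉ W) (hne : ¬ Conn (outer V φ) w u) (hx : Conn (outer V φ) u x) :
    Conn (outer W φ) u x := by
  induction hx with
  | refl => exact Conn.refl _ _
  | @tail b c hb hl ih =>
    rcases (hl.mono (outer_le V φ)).outer_or_inner W with h | h
    · exact ih.tail h
    · exfalso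
      have hbW := h.mem_of_inner.1
      -- The path enters `W` through an edge not inside `W`, so its entry point is joined to `w` by
      -- the hub, along edges outside `V`.
      rcases Relation.ReflTransGen.cases_tail ih with rfl | ⟨b', -, hb'⟩
      · exact hu hbW
      · have := (hW w hw b hbW hwt ⟨b', hb'.symm⟩).mono (inner_le_outer hVW φ)
        exact hne (this.trans (Conn.symm hb))

/-- Disjoint trifurcations are compatible. -/
theorem arms_compatible {V W : Finset (ℤ × ℤ)} (hVW : Disjoint V W) {φ : GridEdge → Bool}
    (hV : IsHub V φ) (hW : IsHub W φ) {n : ℕ} {u w : Fin (n + 1) → ℤ × ℤ}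
    (hu : ∀ a, u a ∈ V ∧ InfiniteAt (outer V φ) (u a))
    (hw : ∀ a, w a ∈ W ∧ InfiniteAt (outer W φ) (w a)) (a : Fin (n + 1)) :
    {v | Conn (outer V φ) (u a) v} = {v | Conn (outer V φ) (w 0) v} ∨
    {v | Conn (outer V φ) (u a) v} ⊆ {v | Conn (outer W φ) (u 0) v} ∧
      Disjoint {v | Conn (outer V φ) (u a) v} {v | Conn (outer V φ) (w 0) v} := by
  -- The point `w 0` stands for all of `W`: the arm of `V` containing it is the exceptional class.
  -- Any other arm uses no edge inside `W`, and the hub `V` joins it to `u 0`.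
  by_cases h : Conn (outer V φ) (w 0) (u a)
  · left
    ext v
    exact ⟨fun hv => h.trans hv, fun hv => h.symm.trans hv⟩
  · right
    constructor
    · intro v hv
      have h1 := Conn.outer_of_not_conn hVW hW (hw 0).1 (hw 0).2.exists_link
        (Finset.disjoint_left.1 hVW (hu a).1) h hv
      exact ((hV _ (hu 0).1 _ (hu a).1 (hu 0).2.exists_link (hu a).2.exists_link).mono
        (inner_le_outer hVW.symm φ)).trans h1
    · rw [Set.disjoint_left]
      intro v hv hv'
      exact h (hv'.trans hv.symm)

/-- The vertices of the square `[a, b]²` on its boundary. -/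
noncomputable def squareBoundary (a b : ℤ) : Finset (ℤ × ℤ) :=
  Finset.Icc a b ×ˢ {a, b} ∪ {a, b} ×ˢ Finset.Icc a b

theorem card_squareBoundary_le (a b : ℤ) :
    (squareBoundary a b).card ≤ 4 * (b + 1 - a).toNat := by
  have h2 : ({a, b} : Finset ℤ).card ≤ 2 := Finset.card_le_two
  refine (Finset.card_union_le _ _).trans ?_
  rw [Finset.card_product, Finset.card_product, Int.card_Icc]
  nlinarith

theorem InfiniteAt.exists_mem_squareBoundary {ψ : GridEdge → Bool} {a b : ℤ} {u : ℤ × ℤ}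
    (hu : u ∈ Finset.Icc (a, a) (b, b)) (h : InfiniteAt ψ u) :
    ∃ y ∈ squareBoundary a b, Conn ψ u y := by
  by_contra! hno
  obtain ⟨v, hv, hvn⟩ := h.exists_notMem_finset (Finset.Icc (a, a) (b, b))
  refine hvn ?_
  clear hvn
  change Conn ψ u v at hv
  induction hv with
  | refl => exact hu
  | @tail x x' hx hl ih =>
    have hxb : x ∉ squareBoundary a b := fun hm => hno x hm hx
    obtain ⟨x1, x2⟩ := x
    simp only [squareBoundary, Finset.mem_union, Finset.mem_product, Finset.mem_Icc,
      Finset.mem_insert, Finset.mem_singleton, Prod.mk_le_mk] at hxb ih ⊢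
    rcases hl.cases with ⟨rfl, -⟩ | ⟨rfl, -⟩ | ⟨rfl, -⟩ | ⟨rfl, -⟩ <;>
      simp only [Prod.mk_le_mk] <;> omega

/-- The number of disjoint trifurcations inside a square is at most the size of its boundary. -/
theorem card_trifurcations_le {ι : Type*} (J : Finset ι) (V : ι → Finset (ℤ × ℤ))
    (φ : GridEdge → Bool) (a b : ℤ) (hV : ∀ j ∈ J, V j ⊆ Finset.Icc (a, a) (b, b))
    (hdisj : ∀ i ∈ J, ∀ j ∈ J, i ≠ j → Disjoint (V i) (V j))
    (htri : ∀ j ∈ J, IsTrifurcation (V j) φ) :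
    J.card ≤ (squareBoundary a b).card := by
  have hex : ∀ j, ∃ u : Fin 3 → ℤ × ℤ, j ∈ J →
      (∀ a, u a ∈ V j ∧ InfiniteAt (outer (V j) φ) (u a)) ∧
      ∀ a b, a ≠ b → ¬ Conn (outer (V j) φ) (u a) (u b) := by
    intro j
    by_cases hj : j ∈ J
    · obtain ⟨u, hu⟩ := (htri j hj).2
      exact ⟨u, fun _ => hu⟩
    · exact ⟨fun _ => 0, fun h => absurd h hj⟩
  choose u hu using hex
  refine card_le_card_of_compatible (fun j a => {v | Conn (outer (V j) φ) (u j a) v}) J _ ?_ ?_ ?_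
  · intro j hj c
    exact ((hu j hj).1 c).2.exists_mem_squareBoundary (hV j hj ((hu j hj).1 c).1)
  · intro j hj c d hcd
    rw [Set.disjoint_left]
    intro v hv hv'
    exact (hu j hj).2 c d hcd (Conn.trans hv (Conn.symm hv'))
  · intro i hi j hj hij
    exact ⟨_, _, arms_compatible (hdisj j hj i hi hij.symm) (htri j hj).1 (htri i hi).1
      (hu j hj).1 (hu i hi).1, arms_compatible (hdisj i hi j hj hij) (htri i hi).1 (htri j hj).1
      (hu i hi).1 (hu j hj).1⟩

/-! ## The law of the primal contours -/

theorem measurableSet_evenConfigs : MeasurableSet evenConfigs := by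
  have : evenConfigs = ⋂ x : ℤ, ⋂ y : ℤ, {φ : GridEdge → Bool |
      ((φ (.horizontal, (x, y)) ^^ φ (.horizontal, (x - 1, y))) ^^
        (φ (.vertical, (x, y)) ^^ φ (.vertical, (x, y - 1)))) = false} := by
    ext φ
    simp only [mem_evenConfigs_iff, Set.mem_iInter, Set.mem_ofPred_eq]
  rw [this]
  have h2 : Measurable fun p : Bool × Bool => p.1 ^^ p.2 := measurable_of_countable _
  have hm : ∀ e : GridEdge, Measurable fun φ : GridEdge → Bool => φ e := measurable_pi_apply
  exact MeasurableSet.iInter fun x => MeasurableSet.iInter fun y => measurableSet_eq_fun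
    (h2.comp ((h2.comp ((hm _).prodMk (hm _))).prodMk (h2.comp ((hm _).prodMk (hm _)))))
    measurable_const

theorem primalPart_contourConfig_horizontal (ω : Omega) (a b : ℤ) :
    primalPart (contourConfig ω) (.horizontal, (a, b)) =
      (ω.1 (2 * a, 2 * b) ^^ ω.1 (2 * a, 2 * b + 1)) := by
  simp [primalPart, contourConfig, AuxEdge.blackFace, Lattice.parity]

theorem primalPart_contourConfig_vertical (ω : Omega) (a b : ℤ) :
    primalPart (contourConfig ω) (.vertical, (a, b)) =
      (ω.1 (2 * a - 1, 2 * b + 1) ^^ ω.1 (2 * a, 2 * b + 1)) := by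
  simp [primalPart, contourConfig, AuxEdge.blackFace, Lattice.parity]

theorem IsConstrained.xor_eq {ω : ℤ × ℤ → Bool} (h : IsConstrained ω) {x y : ℤ}
    (hxy : Even (x + y)) : ((ω (x, y) ^^ ω (x, y + 1)) ^^ (ω (x + 1, y) ^^ ω (x + 1, y + 1))) =
      false := by
  have h := h (x, y) hxy
  simp only [pattern, Prod.mk_add_mk, add_zero] at h
  revert h
  generalize ω (x, y) = a
  generalize ω (x, y + 1) = b
  generalize ω (x + 1, y + 1) = c
  generalize ω (x + 1, y) = d
  revert a b c d
  decide

/-- A vertex of the primal lattice is the centre of a white face. The constraint lets each of its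
four edges be read off from a pair of adjacent corners of that face, and every corner then occurs
twice. -/
theorem primalPart_contourConfig_mem_evenConfigs (ω : Omega) :
    primalPart (contourConfig ω) ∈ evenConfigs := by
  refine mem_evenConfigs_iff.2 fun a b => ?_
  simp only [primalPart_contourConfig_horizontal, primalPart_contourConfig_vertical]
  have h1 := ω.2.xor_eq (x := 2 * (a - 1)) (y := 2 * b) ⟨a - 1 + b, by ring⟩
  have h2 := ω.2.xor_eq (x := 2 * a - 1) (y := 2 * (b - 1) + 1) ⟨a - 1 + b, by ring⟩
  rw [show 2 * (a - 1) + 1 = 2 * a - 1 by ring] at h1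
  rw [show 2 * (b - 1) + 1 + 1 = 2 * b by ring, sub_add_cancel] at h2
  revert h1 h2
  generalize ω.1 (2 * (a - 1), 2 * b) = p1
  generalize ω.1 (2 * (a - 1), 2 * b + 1) = p2
  generalize ω.1 (2 * a - 1, 2 * b) = p3
  generalize ω.1 (2 * a - 1, 2 * b + 1) = p4
  generalize ω.1 (2 * a, 2 * b) = p5
  generalize ω.1 (2 * a, 2 * b + 1) = p6
  generalize ω.1 (2 * a - 1, 2 * (b - 1) + 1) = p7
  generalize ω.1 (2 * a, 2 * (b - 1) + 1) = p8
  revert p1 p2 p3 p4 p5 p6 p7 p8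
  decide

/-- The auxiliary lattice has spacing 2, so translation by `2k z` shifts vertex indices by `k z`. -/
theorem primalPart_contourConfig_translate (k : ℕ) (z : ℤ × ℤ) (ω : Omega) :
    primalPart (contourConfig (translate k z ω)) =
      shift (k * z.1, k * z.2) (primalPart (contourConfig ω)) := by
  funext ⟨d, a, b⟩
  cases d
  · simp only [shift, Prod.mk_add_mk, primalPart_contourConfig_horizontal, translate]
    congr 3 <;> ring_nf
  · simp only [shift, Prod.mk_add_mk, primalPart_contourConfig_vertical, translate]
    congr 3 <;> ring_nf

theorem primalLaw_eq_map (μ : Measure Omega) :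
    primalLaw μ = μ.map fun ω => primalPart (contourConfig ω) :=
  Measure.map_map measurable_primalPart measurable_contourConfig

theorem measurable_primalPart_contourConfig :
    Measurable fun ω : Omega => primalPart (contourConfig ω) :=
  measurable_primalPart.comp measurable_contourConfig

theorem primalLaw_apply (μ : Measure Omega) {E : Set (GridEdge → Bool)} (hE : MeasurableSet E) :
    primalLaw μ E = μ ((fun ω => primalPart (contourConfig ω)) ⁻¹' E) := by
  rw [primalLaw_eq_map, Measure.map_apply measurable_primalPart_contourConfig hE]

instance (μ : Measure Omega) [IsProbabilityMeasure μ] : IsProbabilityMeasure (primalLaw μ) := by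
  rw [primalLaw_eq_map]
  exact Measure.isProbabilityMeasure_map measurable_primalPart_contourConfig.aemeasurable

theorem primalLaw_compl_evenConfigs (μ : Measure Omega) : primalLaw μ evenConfigsᶜ = 0 := by
  rw [primalLaw_apply μ measurableSet_evenConfigs.compl]
  convert measure_empty (μ := μ)
  ext ω
  simp [primalPart_contourConfig_mem_evenConfigs]

theorem primalLaw_preimage_shift {k : ℕ} {μ : Measure Omega} (hinv : IsTranslationInvariant k μ)
    (z : ℤ × ℤ) {E : Set (GridEdge → Bool)} (hE : MeasurableSet E) :
    primalLaw μ (shift (k * z.1, k * z.2) ⁻¹' E) = primalLaw μ E := by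
  rw [primalLaw_apply μ hE, primalLaw_apply μ (measurable_shift _ hE),
    ← (hinv z).measure_preimage (measurable_primalPart_contourConfig hE).nullMeasurableSet]
  congr 1
  ext ω
  simp only [Set.mem_preimage, primalPart_contourConfig_translate]

theorem primalLaw_eq_zero_or_one {k : ℕ} {μ : Measure Omega} (herg : IsTranslationErgodic k μ)
    {E : Set (GridEdge → Bool)} (hE : MeasurableSet E) (hshift : ∀ w, shift w ⁻¹' E = E) :
    primalLaw μ E = 0 ∨ primalLaw μ E = 1 := by
  rw [primalLaw_apply μ hE]
  refine herg _ (measurable_primalPart_contourConfig hE) fun z => ?_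
  ext ω
  have := Set.ext_iff.1 (hshift (k * z.1, k * z.2)) (primalPart (contourConfig ω))
  simpa only [Set.mem_preimage, primalPart_contourConfig_translate] using this

theorem pos_of_preimage_switchFaces {μ : Measure Omega} (hfin : HasFiniteEnergy μ)
    (T : List (ℤ × ℤ)) {E : Set (GridEdge → Bool)} (hE : MeasurableSet E)
    (h : 0 < primalLaw μ (switchFaces T ⁻¹' E)) : 0 < primalLaw μ E := by
  induction T generalizing E with
  | nil => exact h
  | cons c T ih =>
    have h' : 0 < primalLaw μ (switchFace c ⁻¹' E) := ih (measurable_switchFace c hE) h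
    rw [← measure_inter_conull (primalLaw_compl_evenConfigs μ)] at h'
    refine (hfin c _ ((measurable_switchFace c hE).inter measurableSet_evenConfigs)
      Set.inter_subset_right h').trans_le (measure_mono ?_)
    rintro _ ⟨φ, hφ, rfl⟩
    exact hφ.1

/-- Finite energy: an event that can be reached by switching finitely many faces from an event of
positive probability has positive probability. -/
theorem pos_of_forall_exists_switchFaces {μ : Measure Omega} (hfin : HasFiniteEnergy μ)
    {S E : Set (GridEdge → Bool)} (hE : MeasurableSet E) (hS : 0 < primalLaw μ S)
    (h : ∀ φ ∈ S, φ ∈ evenConfigs → ∃ T, switchFaces T φ ∈ E) : 0 < primalLaw μ E := by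
  by_contra hcon
  -- The list `T` may depend on `φ`, but there are only countably many lists, so `S` would be
  -- covered by countably many null sets.
  refine hS.ne' (measure_mono_null (t := (⋃ T, switchFaces T ⁻¹' E) ∪ evenConfigsᶜ) ?_ ?_)
  · intro φ hφ
    by_cases he : φ ∈ evenConfigs
    · exact Or.inl (Set.mem_iUnion.2 (h φ hφ he))
    · exact Or.inr he
  · refine measure_union_null (measure_iUnion_null fun T => ?_) (primalLaw_compl_evenConfigs μ)
    by_contra hT
    exact hcon (pos_of_preimage_switchFaces hfin T hE (pos_iff_ne_zero.2 hT))

/-! ## Uniqueness of the infinite cluster -/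

/-- The radius is written `m + 2` because the filling construction needs radius at least 2. -/
theorem exists_forall_mem_box {n : ℕ} (u : Fin n → ℤ × ℤ) :
    ∃ m : ℕ, ∀ a, u a ∈ box (m + 2 : ℕ) 0 := by
  refine ⟨Finset.univ.sup fun a => (u a).1.natAbs + (u a).2.natAbs, fun a => ?_⟩
  have := Finset.le_sup (f := fun a => (u a).1.natAbs + (u a).2.natAbs) (Finset.mem_univ a)
  simp only [mem_box, Prod.fst_zero, Prod.snd_zero]
  omega

theorem HasDistinct.exists_box {n : ℕ} {φ : GridEdge → Bool}
    (h : HasDistinct n (fun _ => True) φ) :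
    ∃ m : ℕ, HasDistinct n (· ∈ box (m + 2 : ℕ) 0) φ := by
  obtain ⟨u, hu, hne⟩ := h
  obtain ⟨m, hm⟩ := exists_forall_mem_box u
  exact ⟨m, u, fun a => ⟨hm a, (hu a).2⟩, hne⟩

/-- A box meeting two infinite clusters meets all of them, since there is no third; filling it
merges them. -/
theorem exists_switchFaces_hasUniqueInfinite {φ : GridEdge → Bool} (hφ : φ ∈ evenConfigs)
    (h2 : HasDistinct 2 (fun _ => True) φ) (h3 : ¬ HasDistinct 3 (fun _ => True) φ) :
    ∃ T, HasUniqueInfinite (switchFaces T φ) := by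
  obtain ⟨m, u, hu, hne⟩ := h2.exists_box
  obtain ⟨T, hout, hhub⟩ := exists_switchFaces_isHub hφ (m := (m + 2 : ℕ)) (by omega)
  refine ⟨T, hasUniqueInfinite_of_isHub hhub hout fun v hv => ?_⟩
  by_contra! hno
  refine h3 ⟨![u 0, u 1, v], ?_, ?_⟩
  · intro a
    fin_cases a
    exacts [⟨trivial, (hu 0).2⟩, ⟨trivial, (hu 1).2⟩, ⟨trivial, hv⟩]
  · have h01 : ¬ Conn φ (u 0) (u 1) := hne 0 1 (by decide)
    have h0 := hno _ (hu 0).1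
    have h1 := hno _ (hu 1).1
    intro a b hab
    fin_cases a <;> fin_cases b
    exacts [absurd rfl hab, h01, fun h => h0 h.symm, fun h => h01 h.symm, absurd rfl hab,
      fun h => h1 h.symm, h0, h1, absurd rfl hab]

theorem IsTrifurcation.of_isHub {φ ψ : GridEdge → Bool} {V : Finset (ℤ × ℤ)} (hψ : IsHub V ψ)
    (hout : outer V ψ = outer V φ) (h : HasDistinct 3 (· ∈ V) φ) : IsTrifurcation V ψ :=
  ⟨hψ, hout ▸ h.outer⟩

theorem disjoint_box {m : ℕ} {L : ℤ} (hL : 2 * (m : ℤ) + 1 ≤ L) {i j : ℕ × ℕ} (hij : i ≠ j) :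
    Disjoint (box m (L * i.1, L * i.2)) (box m (L * j.1, L * j.2)) := by
  have key : ∀ a b : ℕ, a ≠ b → ∀ x : ℤ, ¬ (L * a - m ≤ x ∧ x ≤ L * a + m ∧
      L * b - m ≤ x ∧ x ≤ L * b + m) := by
    intro a b hab x hx
    rcases lt_or_gt_of_ne hab with h | h
    · have : L * (a + 1) ≤ L * b := mul_le_mul_of_nonneg_left (by exact_mod_cast h) (by omega)
      linarith
    · have : L * (b + 1) ≤ L * a := mul_le_mul_of_nonneg_left (by exact_mod_cast h) (by omega)
      linarith
  rw [Finset.disjoint_left]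
  intro v hv hv'
  rw [mem_box] at hv hv'
  simp only at hv hv'
  rcases Classical.em (i.1 = j.1) with h1 | h1
  · exact key i.2 j.2 (fun h2 => hij (Prod.ext h1 h2)) v.2 ⟨hv.1.2, hv.2.2, hv'.1.2, hv'.2.2⟩
  · exact key i.1 j.1 h1 v.1 ⟨hv.1.1, hv.2.1, hv'.1.1, hv'.2.1⟩

theorem box_subset {m : ℕ} {L : ℤ} (hL : 2 * (m : ℤ) + 1 ≤ L) {r : ℕ} {i : ℕ × ℕ}
    (hi : i ∈ Finset.range r ×ˢ Finset.range r) :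
    box m (L * i.1, L * i.2) ⊆ Finset.Icc (-L, -L) (r * L, r * L) := by
  have key : ∀ a : ℕ, a < r → 0 ≤ L * a ∧ L * a + L ≤ r * L := by
    intro a ha
    refine ⟨mul_nonneg (by omega) (by omega), ?_⟩
    have : L * (a + 1) ≤ L * r := mul_le_mul_of_nonneg_left (by exact_mod_cast ha) (by omega)
    linarith
  simp only [Finset.mem_product, Finset.mem_range] at hi
  have h1 := key _ hi.1
  have h2 := key _ hi.2
  intro v hv
  rw [mem_box] at hv
  simp only at hv
  rw [Finset.mem_Icc, Prod.le_def, Prod.le_def]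
  simp only
  omega

/-- The expected number of trifurcations in a large square is at most the size of its boundary. -/
theorem sum_measure_trifurcation_le (ν : Measure (GridEdge → Bool)) [IsProbabilityMeasure ν]
    {m : ℕ} {L : ℤ} (hL : 2 * (m : ℤ) + 1 ≤ L) (r : ℕ) :
    ∑ j ∈ Finset.range r ×ˢ Finset.range r,
      ν {φ | IsTrifurcation (box m (L * j.1, L * j.2)) φ} ≤
      ((squareBoundary (-L) (r * L)).card : ENNReal) := by
  classical
  have hm := fun j : ℕ × ℕ => measurableSet_isTrifurcation (box m (L * j.1, L * j.2))
  calc _ = ∫⁻ φ, ∑ j ∈ Finset.range r ×ˢ Finset.range r,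
        Set.indicator {φ | IsTrifurcation (box m (L * j.1, L * j.2)) φ} 1 φ ∂ν := by
        rw [lintegral_finsetSum _ fun j _ => measurable_one.indicator (hm j)]
        exact Finset.sum_congr rfl fun j _ => (lintegral_indicator_one (hm j)).symm
    _ ≤ ∫⁻ _, ((squareBoundary (-L) (r * L)).card : ENNReal) ∂ν := by
        refine lintegral_mono fun φ => ?_
        simp only [Set.indicator_apply, Set.mem_ofPred_eq, Pi.one_apply, ← Finset.sum_filter,
          Finset.sum_const, nsmul_eq_mul, mul_one]
        norm_cast
        refine card_trifurcations_le _ (fun j : ℕ × ℕ => box m (L * j.1, L * j.2)) φ _ _ ?_ ?_ ?_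
        · exact fun j hj => box_subset hL (Finset.mem_filter.1 hj).1
        · exact fun i _ j _ hij => disjoint_box hL hij
        · exact fun j hj => (Finset.mem_filter.1 hj).2
    _ = _ := by simp

/-- Trifurcations have probability zero. -/
theorem primalLaw_trifurcation_eq_zero {k : ℕ} (hk : 0 < k) {μ : Measure Omega}
    [IsProbabilityMeasure μ] (hinv : IsTranslationInvariant k μ) (m : ℕ) :
    primalLaw μ {φ | IsTrifurcation (box m 0) φ} = 0 := by
  by_contra hp
  set p := primalLaw μ {φ | IsTrifurcation (box m 0) φ}
  -- The spacing is a multiple of `k`, so that invariance applies, and at least `2m + 1`, so that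
  -- the translated boxes are disjoint.
  obtain ⟨L, hL, hkL⟩ : ∃ L : ℕ, 2 * (m : ℤ) + 1 ≤ L ∧ k ∣ L :=
    ⟨k * (2 * m + 1), by exact_mod_cast Nat.le_mul_of_pos_left _ hk, dvd_mul_right _ _⟩
  obtain ⟨l, rfl⟩ := hkL
  have hle : ∀ j : ℕ × ℕ, p ≤ primalLaw μ
      {φ | IsTrifurcation (box m ((k * l : ℕ) * j.1, (k * l : ℕ) * j.2)) φ} := by
    intro j
    have := primalLaw_preimage_shift hinv ((l * j.1 : ℤ), (l * j.2 : ℤ))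
      (measurableSet_isTrifurcation (box m 0))
    refine this.symm.le.trans (measure_mono fun φ hφ => IsTrifurcation.of_shift ?_ hφ)
    intro v
    simp only [mem_box, Prod.fst_add, Prod.snd_add, Prod.fst_zero, Prod.snd_zero, Nat.cast_mul,
      ← mul_assoc]
    omega
  -- From `r² p ≤ 4 (r k l + 1 + k l) ≤ r · 4 (2 k l + 1)`, after cancelling one factor `r`. The
  -- bound does not depend on `r`, which forces `p = 0`.
  have hb : ∀ r : ℕ, 1 ≤ r → (r : ENNReal) * p ≤ (4 * (2 * (k * l) + 1) : ℕ) := by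
    intro r hr
    have h1 := sum_measure_trifurcation_le (primalLaw μ) hL r
    have h2 := Finset.card_nsmul_le_sum (Finset.range r ×ˢ Finset.range r) _ p fun j _ => hle j
    have h3 : (squareBoundary (-((k * l : ℕ) : ℤ)) (r * (k * l : ℕ))).card ≤
        r * (4 * (2 * (k * l) + 1)) := by
      refine (card_squareBoundary_le _ _).trans ?_
      have e : ((r * (k * l : ℕ) + 1 - -((k * l : ℕ) : ℤ)) : ℤ) =
        ((r * (k * l) + 1 + k * l : ℕ) : ℤ) := by push_cast; ring
      rw [e, Int.toNat_natCast]
      nlinarith [Nat.le_mul_of_pos_left (k * l) hr]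
    have h4 := h2.trans (h1.trans (Nat.cast_le.2 h3))
    rw [Finset.card_product, Finset.card_range, nsmul_eq_mul, Nat.cast_mul, Nat.cast_mul,
      mul_assoc] at h4
    by_contra! hlt
    exact absurd h4 (not_le.2 ((ENNReal.mul_lt_mul_iff_right (by positivity)
      (ENNReal.natCast_ne_top r)).2 hlt))
  obtain ⟨r, hr⟩ := ENNReal.exists_nat_mul_gt hp
    (ENNReal.natCast_ne_top (4 * (2 * (k * l) + 1)))
  have hr1 : 1 ≤ r := by
    rcases Nat.eq_zero_or_pos r with rfl | h
    · simp at hr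
    · exact h
  exact absurd (hb r hr1) (not_le.2 hr)

theorem ae_hasUniqueInfinite {k : ℕ} (hk : 0 < k) {μ : Measure Omega} [IsProbabilityMeasure μ]
    (hinv : IsTranslationInvariant k μ) (herg : IsTranslationErgodic k μ)
    (hfin : HasFiniteEnergy μ) : ∀ᵐ φ ∂primalLaw μ, HasUniqueInfinite φ := by
  have h01 : ∀ n, primalLaw μ {φ | HasDistinct n (fun _ => True) φ} = 0 ∨
      primalLaw μ {φ | HasDistinct n (fun _ => True) φ} = 1 := fun n =>
    primalLaw_eq_zero_or_one herg (measurableSet_hasDistinct n _) fun w =>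
      Set.ext fun φ => hasDistinct_shift n w φ
  have h3 : primalLaw μ {φ | HasDistinct 3 (fun _ => True) φ} = 0 := by
    by_contra hne
    have : ∃ m : ℕ, primalLaw μ {φ | HasDistinct 3 (· ∈ box (m + 2 : ℕ) 0) φ} ≠ 0 := by
      by_contra! hz
      refine hne (measure_mono_null (fun φ hφ => ?_) (measure_iUnion_null hz))
      exact Set.mem_iUnion.2 (HasDistinct.exists_box hφ)
    obtain ⟨m, hm⟩ := this
    refine (pos_of_forall_exists_switchFaces hfin
      (measurableSet_isTrifurcation (box (m + 2 : ℕ) 0)) (pos_iff_ne_zero.2 hm) ?_).ne'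
      (primalLaw_trifurcation_eq_zero hk hinv (m + 2))
    intro φ hφ he
    obtain ⟨T, hout, hhub⟩ := exists_switchFaces_isHub he (m := (m + 2 : ℕ)) (by omega)
    exact ⟨T, IsTrifurcation.of_isHub hhub hout hφ⟩
  have hcompl : {φ | ¬ HasUniqueInfinite φ} = {φ | HasDistinct 2 (fun _ => True) φ} := by
    ext φ
    simp [hasUniqueInfinite_iff]
  rw [ae_iff, hcompl]
  refine (h01 2).resolve_right fun h2 => ?_
  have hm2 := measurableSet_hasDistinct 2 fun _ => True
  refine (pos_of_forall_exists_switchFaces hfin hm2.compl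
    (S := {φ | HasDistinct 2 (fun _ => True) φ} \ {φ | HasDistinct 3 (fun _ => True) φ})
    ?_ ?_).ne' ((prob_compl_eq_zero_iff hm2).2 h2)
  · rw [measure_sdiff_null h3, h2]
    exact one_pos
  · intro φ hφ he
    obtain ⟨T, hT⟩ := exists_switchFaces_hasUniqueInfinite he hφ.1 hφ.2
    exact ⟨T, hasUniqueInfinite_iff.1 hT⟩

/-! ## Contours -/

theorem reachable_of_link {ψ : AuxEdge → Bool} {u v : ℤ × ℤ} (h : Link (primalPart ψ) u v) :
    (presentGraph ψ).Reachable (.primal, u) (.primal, v) := by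
  have key : ∀ e : GridEdge, primalPart ψ e = true →
      (presentGraph ψ).Reachable (.primal, e.src) (.primal, e.tgt) := by
    intro e he
    refine SimpleGraph.Adj.reachable
      ((SimpleGraph.fromEdgeSet_adj _).2 ⟨⟨(.primal, e), he, rfl⟩, ?_⟩)
    obtain ⟨_ | _, x, y⟩ := e <;> simp [GridEdge.src, GridEdge.tgt]
  obtain ⟨e, he, ⟨rfl, rfl⟩ | ⟨rfl, rfl⟩⟩ := h
  · exact key e he
  · exact (key e he).symm

theorem Conn.reachable {ψ : AuxEdge → Bool} {u v : ℤ × ℤ} (h : Conn (primalPart ψ) u v) :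
    (presentGraph ψ).Reachable (.primal, u) (.primal, v) := by
  induction h with
  | refl => exact SimpleGraph.Reachable.refl _
  | tail _ hl ih => exact ih.trans (reachable_of_link hl)

theorem conn_of_reachable {ψ : AuxEdge → Bool} {u : ℤ × ℤ} {y : AuxVertex}
    (h : (presentGraph ψ).Reachable (.primal, u) y) :
    y.1 = .primal ∧ Conn (primalPart ψ) u y.2 := by
  rw [SimpleGraph.reachable_iff_reflTransGen] at h
  induction h with
  | refl => exact ⟨rfl, Conn.refl _ _⟩
  | @tail b c _ hadj ih =>
    obtain ⟨⟨⟨i, e⟩, he, hs⟩, -⟩ := (SimpleGraph.fromEdgeSet_adj _).1 hadj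
    rw [Sym2.eq_iff] at hs
    rcases hs with ⟨rfl, rfl⟩ | ⟨rfl, rfl⟩ <;>
      simp only [AuxEdge.src, AuxEdge.tgt] at ih ⊢ <;> obtain ⟨rfl, ih⟩ := ih
    · exact ⟨rfl, ih.tail ⟨e, he, Or.inl ⟨rfl, rfl⟩⟩⟩
    · exact ⟨rfl, ih.tail ⟨e, he, Or.inr ⟨rfl, rfl⟩⟩⟩

/-- An infinite primal contour lies in an infinite cluster. -/
theorem IsPrimalContour.exists_infiniteAt {ψ : AuxEdge → Bool} {C : Set AuxEdge}
    (h : IsPrimalContour ψ C) (hC : C.Infinite) : ∃ u, InfiniteAt (primalPart ψ) u ∧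
      C = {e | ψ e = true ∧ (presentGraph ψ).Reachable (.primal, u) e.src} := by
  obtain ⟨⟨⟨i, e⟩, he, rfl⟩, hp⟩ := h
  obtain rfl : i = .primal := hp (i, e) ⟨he, SimpleGraph.Reachable.refl _⟩
  refine ⟨e.src, fun hfin => hC ?_, rfl⟩
  -- Each vertex is the first endpoint of only two edges, so a finite cluster carries finitely many
  -- edges.
  refine ((Set.finite_univ (α := Direction)).prod hfin).image
    (fun x : GridEdge => ((.primal, x) : AuxEdge)) |>.subset ?_
  rintro ⟨j, d, v⟩ ⟨-, hr⟩
  obtain ⟨h1, h2⟩ := conn_of_reachable hr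
  obtain rfl : j = .primal := h1
  exact ⟨(d, v), ⟨Set.mem_univ _, h2⟩, rfl⟩

end ConstrainedPercolation

theorem theorem4 (k : ℕ) (hk : 0 < k)
    (μ : MeasureTheory.Measure ConstrainedPercolation.Omega)
    [MeasureTheory.IsProbabilityMeasure μ]
    (hinv : ConstrainedPercolation.IsTranslationInvariant k μ)
    (herg : ConstrainedPercolation.IsTranslationErgodic k μ)
    (hfin : ConstrainedPercolation.HasFiniteEnergy μ) :
    ∀ᵐ ω ∂μ, ∀ C C' : Set ConstrainedPercolation.AuxEdge,
      ConstrainedPercolation.IsPrimalContour (ConstrainedPercolation.contourConfig ω) C →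
      ConstrainedPercolation.IsPrimalContour (ConstrainedPercolation.contourConfig ω) C' →
      C.Infinite → C'.Infinite → C = C' := by
  have h := ConstrainedPercolation.ae_hasUniqueInfinite hk hinv herg hfin
  rw [ConstrainedPercolation.primalLaw_eq_map] at h
  filter_upwards [MeasureTheory.ae_of_ae_map
    ConstrainedPercolation.measurable_primalPart_contourConfig.aemeasurable h]
    with ω hω C C' hC hC' hinf hinf'
  obtain ⟨u, hu, rfl⟩ := hC.exists_infiniteAt hinf
  obtain ⟨v, hv, rfl⟩ := hC'.exists_infiniteAt hinf'
  have huv := (hω u v hu hv).reachable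
  ext e
  exact and_congr_right fun _ => ⟨fun h => huv.symm.trans h, fun h => huv.trans h⟩
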